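/- Let $\{w(k)\}_{k\in\mathbb Z}$ be real numbers with $w(k)<w(k+1)$, $\lim_{k\to\infty}w(k)=w_+$ finite, $\lim_{k\to-\infty}w(k)=0$ and $\sup_k w(k)/w(k-1)<\infty$ (so $w(k)>0$). On $\ell^2(\mathbb Z)$ with canonical basis $\{e_k\}$ let $Ue_k=e_{k+1}$, $f(K)e_k=f(k)e_k$, $U_we_k=w(k)e_{k+1}$, $S=[U_w^*,U_w]$, so that $Se_k=S(k)e_k$ with $S(k)=w(k)^2-w(k-1)^2>0$. Let $C^*(U_w)$ be the (non-unital) $C^*$-algebra generated by $U_w$, and let $\sigma:C^*(U_w)\to C(S^1)$ be the $*$-homomorphism with $\sigma(U_w)=w_+e^{i\varphi}$. Let $\tau(b)=\mathrm{tr}\big(S(U_w^*U_w)^{-1}b\big)$, and let $\mathcal H$ be the GNS Hilbert space of $\tau$: the completion of $\{b\in C^*(U_w):\tau(bb^*)<\infty\}$ in the norm $\|b\|_w^2=\tau(bb^*)$. The matrix coefficients $b_{kj}=\langle e_k,be_j\rangle$ extend continuously to $b\in\mathcal H$ and determine $b$. Put $a(k)=w(k)^2/S(k)$ and $\ell^2_a(\mathbb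 Z)=\{g:\|g\|_a^2=\sum_k a(k)^{-1}|g(k)|^2<\infty\}$. Let $D$ be the operator $Db=-S^{-1}U_w^*[b,U_w]$ in $\mathcal H$ (the formula being read on matrix coefficients) with the Atiyah–Patodi–Singer domain $$\mathrm{dom}(D)=\{b\in\mathcal H:\ Db\in\mathcal H,\ P_{\ge0}\,\sigma(b)=0\},$$ where $P_{\ge0}\sigma(b)=0$ means that for every $m\ge0$ the Fourier coefficient of $\sigma(b)$ at $e^{im\varphi}$, namely $\lim_{k\to\infty}b_{k,k-m}$, is zero. **Theorem.** The formula $b=\sum_{n\in\mathbb Z}g_n(K)(U^*)^n$, i.e. $g_n(k)=b_{k,k+n}$, defines an isometric isomorphism $\mathcal H\cong\bigoplus_{n\in\mathbb Z}\ell^2_a(\mathbb Z)$. There is a (possibly unbounded) operator $Q$ in $\mathcal H$ with $QD=I$ on $\mathrm{dom}(D)$ and $DQ=I$ on $\mathrm{dom}(Q)$. With respect to this decomposition $$Q=\bigoplus_{n\in\mathbb Z}Q^{(n)}=Q^{(0)}+\tilde Q,\qquad \tilde Q=\bigoplus_{n\ne0}Q^{(n)},$$ where the operators $Q^{(n)}$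 in $\ell^2_a(\mathbb Z)$, and the direct sums, are taken on their maximal domains and $$Q^{(n)}g(k)=-\sum_{l<k}\frac{w(l)\cdots w(l+n-1)}{w(k)\cdots w(k+n-1)}\,\frac{S(l)}{w(l)^2}\,g(l)\quad(n>0),$$ $$Q^{(n)}g(k)=\sum_{l\ge k}\frac{w(k+n)\cdots w(k-1)}{w(l+n)\cdots w(l-1)}\,\frac{S(l)}{w(l)^2}\,g(l)\quad(n<0),\qquad Q^{(0)}g(k)=\sum_{l\ge k}\frac{S(l)}{w(l)^2}\,g(l).$$ The operator $\tilde Q$ is defined on all of $\mathcal H$ and bounded, with $$\|\tilde Q\|^2\le4\Big(\sup_{l\in\mathbb Z}\frac{w(l)}{w(l-1)}\Big)^2 .$$ -/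

import Mathlib

open Filter Topology
open scoped ENNReal InnerProductSpace

noncomputable section

namespace QuantumDisk

/-- A sequence of weights `w : ℤ → ℝ`: strictly increasing, convergent at `+∞`, tending to `0` at
`-∞`, with bounded consecutive ratios. -/
structure Weights where
  w : ℤ → ℝ
  lt_succ : ∀ k, w k < w (k + 1)
  exists_lim : ∃ L, Tendsto w atTop (𝓝 L)
  tendsto_zero : Tendsto w atBot (𝓝 0)
  ratio_bdd : BddAbove (Set.range fun k => w k / w (k - 1))

instance : CoeFun Weights (fun _ => ℤ → ℝ) := ⟨Weights.w⟩

namespace Weights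

theorem strictMono (w : Weights) : StrictMono w := strictMono_int_of_lt_succ w.lt_succ

theorem pos (w : Weights) (k : ℤ) : 0 < w k :=
  (w.strictMono.monotone.le_of_tendsto w.tendsto_zero (k - 1)).trans_lt
    (w.strictMono (by lia))

/-- The limit `w_+` of the weights at `+∞`. -/
def plus (w : Weights) : ℝ := w.exists_lim.choose

theorem tendsto_plus (w : Weights) : Tendsto w atTop (𝓝 w.plus) := w.exists_lim.choose_spec

theorem le_plus (w : Weights) (k : ℤ) : w k ≤ w.plus :=
  w.strictMono.monotone.ge_of_tendsto w.tendsto_plus k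

/-- `S(k) = w(k)² - w(k-1)²`. -/
def S (w : Weights) (k : ℤ) : ℝ := w k ^ 2 - w (k - 1) ^ 2

/-- `a(k) = w(k)² / S(k)`. -/
def a (w : Weights) (k : ℤ) : ℝ := w k ^ 2 / w.S k

theorem S_pos (w : Weights) (k : ℤ) : 0 < w.S k := by
  have h1 := w.strictMono (show k - 1 < k by lia)
  have h2 := w.pos (k - 1)
  unfold S
  nlinarith

theorem a_pos (w : Weights) (k : ℤ) : 0 < w.a k :=
  div_pos (pow_pos (w.pos k) 2) (w.S_pos k)

end Weights

/-! ### The operators on `ℓ²(ℤ)` -/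

/-- The Hilbert space of square summable bilateral sequences. -/
abbrev L2Z : Type := lp (fun _ : ℤ => ℂ) 2

/-- The canonical basis vectors. -/
def e (k : ℤ) : L2Z := lp.single 2 k (1 : ℂ)

/-- The bilateral shift `U e_k = e_{k+1}`. -/
def shift : L2Z →L[ℂ] L2Z :=
  LinearMap.mkContinuous
    { toFun := fun x => ⟨fun k => x (k - 1), by
        have h := (lp.memℓp x).summable (by norm_num)
        exact memℓp_gen ((Equiv.subRight (1 : ℤ)).summable_iff.2 h)⟩
      map_add' := fun x y => by ext k; simp; rfl
      map_smul' := fun c x => by ext k; simp }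
    1 (fun x => by
      rw [one_mul]
      refine lp.norm_le_of_tsum_le (by norm_num) (norm_nonneg x) ?_
      rw [lp.norm_rpow_eq_tsum (by norm_num) x]
      exact ((Equiv.subRight (1 : ℤ)).tsum_eq (fun k => ‖x k‖ ^ (2 : ℝ≥0∞).toReal)).le)

/-- The diagonal operator `f(K) e_k = f(k) e_k` for a bounded function `f`. -/
def diag (f : ℤ → ℂ) (C : ℝ) (hf : ∀ k, ‖f k‖ ≤ C) : L2Z →L[ℂ] L2Z :=
  LinearMap.mkContinuous
    { toFun := fun x => ⟨fun k => f k * x k,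
        Memℓp.mono' ((lp.memℓp x).const_smul ((C : ℝ) : ℂ)) (fun k => by
          have h0 : (0 : ℝ) ≤ C := (norm_nonneg (f k)).trans (hf k)
          rw [norm_mul, Pi.smul_apply, norm_smul, Complex.norm_real, Real.norm_of_nonneg h0]
          gcongr
          exact hf k)⟩
      map_add' := fun x y => by ext k; simp [mul_add]; rfl
      map_smul' := fun c x => by ext k; simp; ring }
    C (fun x => by
      have h0 : (0 : ℝ) ≤ C := (norm_nonneg (f 0)).trans (hf 0)
      have h1 : ‖((C : ℝ) : ℂ) • x‖ = C * ‖x‖ := by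
        rw [norm_smul, Complex.norm_real, Real.norm_of_nonneg h0]
      rw [← h1]
      refine lp.norm_mono (by norm_num) (fun k => ?_)
      change ‖f k * x k‖ ≤ ‖(((C : ℝ) : ℂ) • x) k‖
      rw [norm_mul, lp.coeFn_smul, Pi.smul_apply, norm_smul, Complex.norm_real,
        Real.norm_of_nonneg h0]
      gcongr
      exact hf k)

@[simp] theorem shift_apply (x : L2Z) (k : ℤ) : shift x k = x (k - 1) := rfl

@[simp] theorem diag_apply (f : ℤ → ℂ) (C : ℝ) (hf : ∀ k, ‖f k‖ ≤ C) (x : L2Z) (k : ℤ) :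
    diag f C hf x k = f k * x k := rfl

theorem e_apply (k j : ℤ) : e k j = if j = k then 1 else 0 := by
  simp [e, lp.single_apply, Pi.single_apply]

theorem inner_e (k : ℤ) (x : L2Z) : ⟪e k, x⟫_ℂ = x k := by
  simp [e, lp.inner_single_left]

/-- The weighted shift `U_w = U w(K)`. -/
def Uw (w : Weights) : L2Z →L[ℂ] L2Z :=
  shift ∘L diag (fun k => (w k : ℂ)) w.plus (fun k => by
    rw [Complex.norm_real, Real.norm_of_nonneg (w.pos k).le]; exact w.le_plus k)

theorem Uw_apply (w : Weights) (x : L2Z) (k : ℤ) : Uw w x k = w (k - 1) * x (k - 1) := rfl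

theorem Uw_e (w : Weights) (k : ℤ) : Uw w (e k) = (w k : ℂ) • e (k + 1) := by
  ext j
  rw [Uw_apply, lp.coeFn_smul, Pi.smul_apply, e_apply, e_apply, smul_eq_mul]
  by_cases h : j = k + 1
  · subst h; simp
  · rw [if_neg h, if_neg (by lia)]; simp

theorem star_Uw_apply (w : Weights) (x : L2Z) (k : ℤ) :
    star (Uw w) x k = w k * x (k + 1) := by
  rw [← inner_e, ContinuousLinearMap.star_eq_adjoint, ContinuousLinearMap.adjoint_inner_right,
    Uw_e, inner_smul_left, inner_e]
  simp

theorem star_Uw_e (w : Weights) (k : ℤ) :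
    star (Uw w) (e k) = (w (k - 1) : ℂ) • e (k - 1) := by
  ext j
  rw [star_Uw_apply, lp.coeFn_smul, Pi.smul_apply, e_apply, e_apply, smul_eq_mul]
  by_cases h : j = k - 1
  · subst h; simp
  · rw [if_neg h, if_neg (by lia)]; simp

/-- The commutator `S = [U_w^*, U_w]` is the diagonal operator with eigenvalues `S(k)`. -/
theorem commutator_e (w : Weights) (k : ℤ) :
    (star (Uw w) * Uw w - Uw w * star (Uw w)) (e k) = (w.S k : ℂ) • e k := by
  simp only [sub_apply, mul_apply_eq_comp, Uw_e, star_Uw_e,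
    map_smul, smul_smul, add_sub_cancel_right, sub_add_cancel, ← sub_smul, Weights.S]
  congr 1
  push_cast
  ring

/-- `U_w^* U_w` is the diagonal operator with eigenvalues `w(k)²`. -/
theorem star_Uw_mul_Uw_e (w : Weights) (k : ℤ) :
    (star (Uw w) * Uw w) (e k) = ((w k : ℂ) ^ 2) • e k := by
  simp only [mul_apply_eq_comp, Uw_e, star_Uw_e,
    map_smul, smul_smul, add_sub_cancel_right, sq]

/-- The quantum punctured disk: the (non-unital) C*-algebra generated by `U_w`. -/
def punctDisk (w : Weights) : NonUnitalStarSubalgebra ℂ (L2Z →L[ℂ] L2Z) :=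
  NonUnitalStarAlgebra.elemental ℂ (Uw w)

/-- The eigenvalue of `S (U_w^* U_w)⁻¹` at `e_k`. -/
def density (w : Weights) (k : ℤ) : ℝ := w.S k / w k ^ 2

theorem density_pos (w : Weights) (k : ℤ) : 0 < density w k :=
  div_pos (w.S_pos k) (pow_pos (w.pos k) 2)

/-- The weight `τ(x) = tr(S (U_w^* U_w)⁻¹ x) ∈ [0, ∞]` of a positive operator `x`, the trace being
computed in the eigenbasis `e_k` of `S (U_w^* U_w)⁻¹`. -/
def tau (w : Weights) (x : L2Z →L[ℂ] L2Z) : ℝ≥0∞ :=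
  ∑' k : ℤ, ENNReal.ofReal (density w k * (⟪e k, x (e k)⟫_ℂ).re)

theorem inner_mul_star (b c : L2Z →L[ℂ] L2Z) (k : ℤ) :
    ⟪e k, (c * star b) (e k)⟫_ℂ = ⟪star c (e k), star b (e k)⟫_ℂ := by
  rw [mul_apply_eq_comp, ContinuousLinearMap.star_eq_adjoint c,
    ContinuousLinearMap.adjoint_inner_left]

theorem tau_mul_star_lt_top (w : Weights) (b : L2Z →L[ℂ] L2Z) :
    tau w (b * star b) < ∞ ↔ Summable fun k => density w k * ‖star b (e k)‖ ^ 2 := by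
  have h : ∀ k, density w k * (⟪e k, (b * star b) (e k)⟫_ℂ).re =
      density w k * ‖star b (e k)‖ ^ 2 := fun k => by
    rw [inner_mul_star, inner_self_eq_norm_sq_to_K]
    norm_cast
  rw [tau, lt_top_iff_ne_top]
  simp_rw [h]
  refine ⟨fun H => ?_, fun H => H.tsum_ofReal_ne_top⟩
  have := ENNReal.summable_toReal H
  refine this.congr fun k => ENNReal.toReal_ofReal ?_
  have := density_pos w k
  positivity

/-- The elements `b` of the quantum punctured disk with `τ(b b^*) < ∞`. -/
def finiteWeight (w : Weights) : Submodule ℂ (L2Z →L[ℂ] L2Z) where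
  carrier := {b | b ∈ punctDisk w ∧ tau w (b * star b) < ∞}
  zero_mem' := ⟨zero_mem _, by rw [tau_mul_star_lt_top]; simp [summable_zero]⟩
  add_mem' := by
    rintro b c ⟨hb, hb'⟩ ⟨hc, hc'⟩
    rw [tau_mul_star_lt_top] at hb' hc'
    refine ⟨add_mem hb hc, ?_⟩
    rw [tau_mul_star_lt_top]
    refine Summable.of_nonneg_of_le (fun k => ?_) (fun k => ?_) ((hb'.add hc').mul_left 2)
    · have := density_pos w k
      positivity
    · have h1 := density_pos w k
      have h2 : ‖star (b + c) (e k)‖ ≤ ‖star b (e k)‖ + ‖star c (e k)‖ := by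
        rw [star_add]; exact norm_add_le _ _
      have h3 : ‖star (b + c) (e k)‖ ^ 2 ≤ 2 * (‖star b (e k)‖ ^ 2 + ‖star c (e k)‖ ^ 2) := by
        have := norm_nonneg (star (b + c) (e k))
        nlinarith [sq_nonneg (‖star b (e k)‖ - ‖star c (e k)‖)]
      nlinarith
  smul_mem' := by
    rintro r b ⟨hb, hb'⟩
    rw [tau_mul_star_lt_top] at hb'
    refine ⟨SMulMemClass.smul_mem r hb, ?_⟩
    rw [tau_mul_star_lt_top]
    refine (hb'.mul_left (‖r‖ ^ 2)).congr fun k => ?_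
    rw [star_smul, smul_apply, norm_smul, norm_star]
    ring

/-- The same space, to carry the norm of the GNS construction instead of the operator norm. -/
def PreGNS (w : Weights) : Type := finiteWeight w

instance (w : Weights) : AddCommGroup (PreGNS w) := inferInstanceAs (AddCommGroup (finiteWeight w))
instance (w : Weights) : Module ℂ (PreGNS w) := inferInstanceAs (Module ℂ (finiteWeight w))

/-- The underlying operator. -/
def PreGNS.op {w : Weights} : PreGNS w →ₗ[ℂ] (L2Z →L[ℂ] L2Z) := (finiteWeight w).subtype

theorem PreGNS.op_injective {w : Weights} : Function.Injective (PreGNS.op (w := w)) :=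
  Subtype.val_injective

theorem PreGNS.summable {w : Weights} (b : PreGNS w) :
    Summable fun k => density w k * ‖star b.op (e k)‖ ^ 2 :=
  (tau_mul_star_lt_top w _).1 (Subtype.property (p := (· ∈ finiteWeight w)) b).2

theorem PreGNS.summable_inner {w : Weights} (b c : PreGNS w) :
    Summable fun k => (density w k : ℂ) * ⟪e k, (c.op * star b.op) (e k)⟫_ℂ := by
  refine Summable.of_norm_bounded (b.summable.add c.summable) fun k => ?_
  have h1 := density_pos w k
  rw [inner_mul_star, norm_mul, Complex.norm_real, Real.norm_of_nonneg h1.le]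
  have h2 := norm_inner_le_norm (𝕜 := ℂ) (star c.op (e k)) (star b.op (e k))
  nlinarith [sq_nonneg (‖star b.op (e k)‖ - ‖star c.op (e k)‖),
    sq_nonneg (‖star b.op (e k)‖), sq_nonneg (‖star c.op (e k)‖),
    norm_nonneg (star b.op (e k)), norm_nonneg (star c.op (e k))]

theorem op_ext {b c : L2Z →L[ℂ] L2Z} (h : ∀ k, star b (e k) = star c (e k)) : b = c := by
  ext x k
  have key : ∀ (b : L2Z →L[ℂ] L2Z), (b x) k = ⟪star b (e k), x⟫_ℂ := fun b => by
    rw [ContinuousLinearMap.star_eq_adjoint, ContinuousLinearMap.adjoint_inner_left, inner_e]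
  rw [key, key, h]

theorem inner_self_eq {w : Weights} (b : PreGNS w) :
    ∑' k : ℤ, (density w k : ℂ) * ⟪e k, (b.op * star b.op) (e k)⟫_ℂ =
      ((∑' k, density w k * ‖star b.op (e k)‖ ^ 2 : ℝ) : ℂ) := by
  rw [Complex.ofReal_tsum]
  refine tsum_congr fun k => ?_
  rw [inner_mul_star, inner_self_eq_norm_sq_to_K]
  simp

/-- The inner product `⟨b, c⟩_τ = τ(c b^*)` (linear in `c`) of the GNS construction, so that
`‖b‖² = τ(b b^*)`. -/
@[reducible]
def gnsCore (w : Weights) : InnerProductSpace.Core ℂ (PreGNS w) where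
  inner b c := ∑' k : ℤ, (density w k : ℂ) * ⟪e k, (c.op * star b.op) (e k)⟫_ℂ
  conj_inner_symm b c := by
    rw [Complex.conj_tsum]
    refine tsum_congr fun k => ?_
    rw [map_mul, inner_mul_star, inner_mul_star, inner_conj_symm, Complex.conj_ofReal]
  re_inner_nonneg b := by
    rw [inner_self_eq]
    refine (tsum_nonneg fun k => ?_ : (0 : ℝ) ≤ _)
    have := density_pos w k
    positivity
  add_left b c d := by
    rw [← (PreGNS.summable_inner b d).tsum_add (PreGNS.summable_inner c d)]
    refine tsum_congr fun k => ?_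
    rw [map_add, star_add, mul_add, add_apply, inner_add_right, mul_add]
  smul_left b c r := by
    rw [← tsum_mul_left]
    refine tsum_congr fun k => ?_
    rw [map_smul, star_smul, mul_smul_comm, smul_apply, inner_smul_right]
    simp only [starRingEnd_apply]
    ring
  definite b hb := by
    rw [inner_self_eq, Complex.ofReal_eq_zero] at hb
    have hnn : ∀ k, 0 ≤ density w k * ‖star b.op (e k)‖ ^ 2 := fun k => by
      have := density_pos w k
      positivity
    have h := (hasSum_zero_iff_of_nonneg hnn).1 (hb ▸ b.summable.hasSum)
    apply PreGNS.op_injective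
    rw [map_zero]
    refine op_ext fun k => ?_
    have hk := congrFun h k
    have := density_pos w k
    simpa [this.ne'] using hk

instance (w : Weights) : NormedAddCommGroup (PreGNS w) :=
  (gnsCore w).toNormedAddCommGroup

instance (w : Weights) : InnerProductSpace ℂ (PreGNS w) :=
  InnerProductSpace.ofCore (gnsCore w).toCore

/-- The GNS Hilbert space `ℋ`. -/
abbrev GNS (w : Weights) : Type := UniformSpace.Completion (PreGNS w)

/-! ### The symbol map `σ : C*(U_w) → C(S¹)` -/

instance : Fact (0 < 2 * Real.pi) := ⟨Real.two_pi_pos⟩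

/-- Functions on the circle with angle coordinate `φ ∈ ℝ/2πℤ`; `fourier m` is `e^{imφ}`. -/
abbrev CircleFun : Type := C(AddCircle (2 * Real.pi), ℂ)

theorem fourierCoeff_add' (f g : CircleFun) (m : ℤ) :
    fourierCoeff (⇑(f + g)) m = fourierCoeff f m + fourierCoeff g m := by
  have hi : ∀ f : CircleFun, MeasureTheory.Integrable f AddCircle.haarAddCircle := fun f =>
    f.continuous.integrable_of_hasCompactSupport (HasCompactSupport.of_compactSpace f)
  rw [ContinuousMap.coe_add, fourierCoeff.add (hi f) (hi g), Pi.add_apply]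

theorem fourierCoeff_smul' (c : ℂ) (f : CircleFun) (m : ℤ) :
    fourierCoeff (⇑(c • f)) m = c * fourierCoeff f m := fourierCoeff.const_smul f c m

theorem fourierCoeff_fourier_mul (j : ℤ) (f : CircleFun) (m : ℤ) :
    fourierCoeff (⇑((fourier j : CircleFun) * f)) m = fourierCoeff f (m - j) := by
  refine MeasureTheory.integral_congr_ae (Eventually.of_forall fun t => ?_)
  change fourier (-m) t * (fourier j t * f t) = fourier (-(m - j)) t * f t
  rw [← mul_assoc, ← fourier_add]
  congr 2
  ring_nf

theorem norm_fourierCoeff_le (f : CircleFun) (m : ℤ) : ‖fourierCoeff f m‖ ≤ ‖f‖ := by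
  have h := MeasureTheory.norm_integral_le_of_norm_le_const
    (μ := AddCircle.haarAddCircle (T := 2 * Real.pi)) (f := fun t => fourier (-m) t • f t)
    (C := ‖f‖) (Eventually.of_forall fun t => by
      rw [norm_smul, fourier_apply, Circle.norm_coe, one_mul]; exact f.norm_coe_le_norm t)
  simpa [fourierCoeff] using h

theorem circleFun_ext {f : CircleFun} (h : ∀ m, fourierCoeff f m = 0) : f = 0 := by
  have hs : Summable (fourierCoeff f) := by
    rw [show fourierCoeff (f : AddCircle (2 * Real.pi) → ℂ) = fun _ => 0 from funext h]
    exact summable_zero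
  have := hasSum_fourier_series_of_summable hs
  simp only [h, zero_smul] at this
  exact this.unique hasSum_zero

/-- `f` is the symbol of the operator `x`, in terms of Fourier coefficients. -/
def HasSymbol (p : (L2Z →L[ℂ] L2Z) × CircleFun) : Prop :=
  ∀ m : ℤ, Tendsto (fun k => ⟪e k, p.1 (e (k - m))⟫_ℂ) atTop (𝓝 (fourierCoeff p.2 m))

theorem norm_e (k : ℤ) : ‖e k‖ = 1 := by
  rw [e, lp.norm_single (by norm_num)]; simp

theorem isClosed_hasSymbol : IsClosed {p | HasSymbol p} := by
  refine isClosed_of_closure_subset fun p hp m => ?_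
  rw [Metric.tendsto_atTop]
  intro ε hε
  obtain ⟨q, hq, hpq⟩ := Metric.mem_closure_iff.1 hp (ε / 3) (by positivity)
  obtain ⟨N, hN⟩ := Metric.tendsto_atTop.1 (hq m) (ε / 3) (by positivity)
  refine ⟨N, fun k hk => ?_⟩
  have h1 : dist (⟪e k, p.1 (e (k - m))⟫_ℂ) (⟪e k, q.1 (e (k - m))⟫_ℂ) ≤ ‖p.1 - q.1‖ := by
    rw [dist_eq_norm, ← inner_sub_right, ← sub_apply]
    refine (norm_inner_le_norm _ _).trans ?_
    rw [norm_e, one_mul]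
    refine ((p.1 - q.1).le_opNorm _).trans ?_
    rw [norm_e, mul_one]
  have h2 : dist (fourierCoeff q.2 m) (fourierCoeff p.2 m) ≤ ‖p.2 - q.2‖ := by
    have h3 : fourierCoeff p.2 m = fourierCoeff (⇑(p.2 - q.2)) m + fourierCoeff q.2 m := by
      rw [← fourierCoeff_add', sub_add_cancel]
    rw [dist_comm, dist_eq_norm, h3, add_sub_cancel_right]
    exact norm_fourierCoeff_le _ _
  have h4 : ‖p.1 - q.1‖ < ε / 3 := (norm_fst_le (p - q)).trans_lt (by rwa [← dist_eq_norm])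
  have h5 : ‖p.2 - q.2‖ < ε / 3 := (norm_snd_le (p - q)).trans_lt (by rwa [← dist_eq_norm])
  have h6 := hN k hk
  have := dist_triangle4 (⟪e k, p.1 (e (k - m))⟫_ℂ) (⟪e k, q.1 (e (k - m))⟫_ℂ)
    (fourierCoeff q.2 m) (fourierCoeff p.2 m)
  linarith

theorem HasSymbol.add {p q : (L2Z →L[ℂ] L2Z) × CircleFun} (hp : HasSymbol p) (hq : HasSymbol q) :
    HasSymbol (p + q) := fun m => by
  rw [Prod.snd_add, fourierCoeff_add']
  refine ((hp m).add (hq m)).congr fun k => ?_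
  rw [← inner_add_right]; rfl

theorem HasSymbol.smul {p : (L2Z →L[ℂ] L2Z) × CircleFun} (c : ℂ) (hp : HasSymbol p) :
    HasSymbol (c • p) := fun m => by
  rw [Prod.smul_snd, fourierCoeff_smul']
  refine ((hp m).const_mul c).congr fun k => ?_
  rw [← inner_smul_right]; rfl

theorem HasSymbol.zero : HasSymbol 0 := fun m => by
  simp [fourierCoeff]

/-- The pair `(U_w, w_+ e^{iφ})`. -/
def genPair (w : Weights) : (L2Z →L[ℂ] L2Z) × CircleFun := (Uw w, (w.plus : ℂ) • fourier 1)

theorem HasSymbol.gen_mul {w : Weights} {p : (L2Z →L[ℂ] L2Z) × CircleFun} (hp : HasSymbol p) :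
    HasSymbol (genPair w * p) := fun m => by
  rw [genPair, Prod.snd_mul, smul_mul_assoc, fourierCoeff_smul', fourierCoeff_fourier_mul]
  have h1 : Tendsto (fun k : ℤ => k - 1) atTop atTop := tendsto_atTop_add_const_right _ (-1) tendsto_id
  have h2 := ((Complex.continuous_ofReal.tendsto _).comp (w.tendsto_plus.comp h1)).mul
    ((hp (m - 1)).comp h1)
  refine h2.congr fun k => ?_
  simp only [Function.comp_apply, inner_e, Prod.fst_mul, mul_apply_eq_comp, Uw_apply]
  rw [show k - 1 - (m - 1) = k - m by ring]

theorem star_smul_fourier (c : ℝ) :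
    star ((c : ℂ) • fourier 1 : CircleFun) = (c : ℂ) • fourier (-1) := by
  ext t
  simp only [ContinuousMap.star_apply, ContinuousMap.smul_apply, smul_eq_mul, star_mul',
    fourier_neg, Complex.star_def, Complex.conj_ofReal]

theorem HasSymbol.star_gen_mul {w : Weights} {p : (L2Z →L[ℂ] L2Z) × CircleFun}
    (hp : HasSymbol p) : HasSymbol (star (genPair w) * p) := fun m => by
  rw [genPair, Prod.snd_mul, Prod.snd_star, star_smul_fourier, smul_mul_assoc,
    fourierCoeff_smul', fourierCoeff_fourier_mul]
  have h1 : Tendsto (fun k : ℤ => k + 1) atTop atTop := tendsto_atTop_add_const_right _ 1 tendsto_id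
  have h2 := ((Complex.continuous_ofReal.tendsto _).comp w.tendsto_plus).mul
    ((hp (m - -1)).comp h1)
  refine h2.congr fun k => ?_
  simp only [Function.comp_apply, inner_e, Prod.fst_mul, mul_apply_eq_comp, Prod.fst_star,
    star_Uw_apply]
  rw [show k + 1 - (m - -1) = k - m by ring]

theorem hasSymbol_one : HasSymbol 1 := fun m => by
  have h : fourierCoeff (⇑(1 : CircleFun)) m = if m = 0 then 1 else 0 := by
    have h0 : (1 : CircleFun) = fourier 0 := by ext t; simp
    rw [h0, fourierCoeff_fourier, Pi.single_apply]
  change Tendsto (fun k => ⟪e k, e (k - m)⟫_ℂ) atTop (𝓝 (fourierCoeff (⇑(1 : CircleFun)) m))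
  rw [h]
  refine tendsto_const_nhds.congr fun k => ?_
  rw [inner_e, e_apply]
  have : k = k - m ↔ m = 0 := by lia
  simp only [this]

/-- The C*-algebra generated by the pair `(U_w, w_+ e^{iφ})`; it is the graph of `σ`. -/
def symbolGraph (w : Weights) : NonUnitalStarSubalgebra ℂ ((L2Z →L[ℂ] L2Z) × CircleFun) :=
  NonUnitalStarAlgebra.elemental ℂ (genPair w)

theorem hasSymbol_of_mem {w : Weights} {p : (L2Z →L[ℂ] L2Z) × CircleFun}
    (hp : p ∈ symbolGraph w) : HasSymbol p := by
  have key : ∀ p ∈ symbolGraph w, ∀ q, HasSymbol q → HasSymbol (p * q) := by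
    intro p hp q hq
    have hc : IsClosed {p : (L2Z →L[ℂ] L2Z) × CircleFun | HasSymbol (p * q)} :=
      isClosed_hasSymbol.preimage (continuous_mul_const q)
    refine closure_minimal (fun p hp => ?_) hc hp
    have hp' : p ∈ NonUnitalAlgebra.adjoin ℂ ({genPair w} ∪ star {genPair w}) := hp
    clear hc hp
    change HasSymbol (p * q)
    induction hp' using NonUnitalAlgebra.adjoin_induction generalizing q with
    | mem x hx =>
      rcases hx with hx | hx
      · rw [Set.mem_singleton_iff.1 hx]; exact hq.gen_mul
      · rw [← star_star x, Set.mem_singleton_iff.1 hx]; exact hq.star_gen_mul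
    | add x y _ _ hx hy => rw [add_mul]; exact (hx q hq).add (hy q hq)
    | zero => rw [zero_mul]; exact HasSymbol.zero
    | mul x y _ _ hx hy => rw [mul_assoc]; exact hx _ (hy q hq)
    | smul r x _ hx => rw [smul_mul_assoc]; exact (hx q hq).smul r
  simpa using key p hp 1 hasSymbol_one

/-- The first projection of the graph of `σ`. -/
def graphFst (w : Weights) : symbolGraph w →⋆ₙₐ[ℂ] (L2Z →L[ℂ] L2Z) :=
  (NonUnitalStarAlgHom.fst ℂ (L2Z →L[ℂ] L2Z) CircleFun).comp
    (NonUnitalStarSubalgebraClass.subtype (symbolGraph w))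

theorem graphFst_injective (w : Weights) : Function.Injective (graphFst w) := by
  rw [injective_iff_map_eq_zero]
  rintro ⟨p, hp⟩ h
  have h1 : p.1 = 0 := h
  have h2 : p.2 = 0 := circleFun_ext fun m => by
    refine tendsto_nhds_unique (hasSymbol_of_mem hp m) ?_
    simp [h1]
  exact Subtype.ext (Prod.ext h1 h2)

instance (w : Weights) : NonUnitalCStarAlgebra (symbolGraph w) :=
  inferInstanceAs (NonUnitalCStarAlgebra (NonUnitalStarAlgebra.elemental ℂ (genPair w)))

theorem exists_graph (w : Weights) (b : punctDisk w) : ∃ p : symbolGraph w, graphFst w p = b := by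
  have hiso : Isometry (graphFst w) :=
    NonUnitalStarAlgHom.isometry _ (graphFst_injective w)
  have hcl : IsClosed (NonUnitalStarAlgHom.range (graphFst w) : Set (L2Z →L[ℂ] L2Z)) := by
    rw [NonUnitalStarAlgHom.coe_range]
    exact hiso.isClosedEmbedding.isClosed_range
  have hle : punctDisk w ≤ NonUnitalStarAlgHom.range (graphFst w) :=
    NonUnitalStarAlgebra.elemental.le_of_mem hcl
      ⟨⟨genPair w, NonUnitalStarAlgebra.elemental.self_mem ℂ _⟩, rfl⟩
  exact hle b.2

/-- The restriction to the boundary `σ : C*(U_w) → C(S¹)`, the *-homomorphism with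
`σ(U_w) = w_+ e^{iφ}`. -/
def symbol (w : Weights) : punctDisk w →⋆ₙₐ[ℂ] CircleFun where
  toFun b := (exists_graph w b).choose.1.2
  map_smul' c b := by
    have h : (exists_graph w (c • b)).choose = c • (exists_graph w b).choose :=
      graphFst_injective w (by
        rw [(exists_graph w (c • b)).choose_spec, map_smul, (exists_graph w b).choose_spec]; rfl)
    rw [h]; rfl
  map_zero' := by
    have h : (exists_graph w 0).choose = 0 :=
      graphFst_injective w (by rw [(exists_graph w 0).choose_spec, map_zero]; rfl)
    rw [h]; rfl
  map_add' b c := by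
    have h : (exists_graph w (b + c)).choose =
        (exists_graph w b).choose + (exists_graph w c).choose :=
      graphFst_injective w (by
        rw [(exists_graph w (b + c)).choose_spec, map_add, (exists_graph w b).choose_spec,
          (exists_graph w c).choose_spec]; rfl)
    rw [h]; rfl
  map_mul' b c := by
    have h : (exists_graph w (b * c)).choose =
        (exists_graph w b).choose * (exists_graph w c).choose :=
      graphFst_injective w (by
        rw [(exists_graph w (b * c)).choose_spec, map_mul, (exists_graph w b).choose_spec,
          (exists_graph w c).choose_spec]; rfl)
    rw [h]; rfl
  map_star' b := by
    have h : (exists_graph w (star b)).choose = star (exists_graph w b).choose :=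
      graphFst_injective w (by
        rw [(exists_graph w (star b)).choose_spec, map_star, (exists_graph w b).choose_spec]; rfl)
    rw [h]; rfl

theorem Uw_mem (w : Weights) : Uw w ∈ punctDisk w := NonUnitalStarAlgebra.elemental.self_mem ℂ _

theorem symbol_Uw (w : Weights) :
    symbol w ⟨Uw w, Uw_mem w⟩ =
      (w.plus : ℂ) • fourier 1 := by
  have h : (exists_graph w ⟨Uw w, Uw_mem w⟩).choose =
      ⟨genPair w, NonUnitalStarAlgebra.elemental.self_mem ℂ _⟩ :=
    graphFst_injective w (by rw [(exists_graph w ⟨Uw w, Uw_mem w⟩).choose_spec]; rfl)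
  change (exists_graph w ⟨Uw w, Uw_mem w⟩).choose.1.2 = _
  rw [h]; rfl

/-- For `b ∈ C*(U_w)`, the Fourier coefficient of `σ(b)` at `e^{imφ}` is
`lim_{k → ∞} ⟨e_k, b e_{k-m}⟩`. -/
theorem tendsto_fourierCoeff_symbol (w : Weights) (b : punctDisk w) (m : ℤ) :
    Tendsto (fun k => ⟪e k, (b : L2Z →L[ℂ] L2Z) (e (k - m))⟫_ℂ) atTop
      (𝓝 (fourierCoeff (symbol w b) m)) := by
  have h := hasSymbol_of_mem (exists_graph w b).choose.2 m
  have h2 : (exists_graph w b).choose.1.1 = b := (exists_graph w b).choose_spec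
  rw [h2] at h
  exact h

theorem PreGNS.norm_sq {w : Weights} (b : PreGNS w) :
    ‖b‖ ^ 2 = ∑' k, density w k * ‖star b.op (e k)‖ ^ 2 := by
  rw [← inner_self_eq_norm_sq (𝕜 := ℂ) b]
  change (∑' k : ℤ, (density w k : ℂ) * ⟪e k, (b.op * star b.op) (e k)⟫_ℂ).re = _
  rw [inner_self_eq, Complex.ofReal_re]

/-- The square of the norm of `ℋ` is given by the weight: `‖b‖² = τ(b b^*)`. -/
theorem PreGNS.ofReal_norm_sq {w : Weights} (b : PreGNS w) :
    ENNReal.ofReal (‖b‖ ^ 2) = tau w (b.op * star b.op) := by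
  rw [b.norm_sq, ENNReal.ofReal_tsum_of_nonneg _ b.summable, tau]
  · refine tsum_congr fun k => ?_
    rw [inner_mul_star, inner_self_eq_norm_sq_to_K]
    norm_cast
  · intro k
    have := density_pos w k
    positivity

/-! ### Matrix coefficients of elements of `ℋ` -/

theorem hasSum_row (b : L2Z →L[ℂ] L2Z) (k : ℤ) :
    HasSum (fun j => ‖⟪e k, b (e j)⟫_ℂ‖ ^ 2) (‖star b (e k)‖ ^ 2) := by
  have h := lp.hasSum_norm (p := 2) (by norm_num) (star b (e k))
  have h2 : (2 : ℝ≥0∞).toReal = ((2 : ℕ) : ℝ) := by norm_num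
  simp only [h2, Real.rpow_natCast] at h
  convert h using 3 with j
  rw [← inner_e j, ← inner_conj_symm, RCLike.norm_conj, ContinuousLinearMap.star_eq_adjoint,
    ContinuousLinearMap.adjoint_inner_right]

theorem norm_embed (w : Weights) (b : L2Z →L[ℂ] L2Z) (p : ℤ × ℤ) :
    ‖(√(density w p.1) : ℂ) * ⟪e p.1, b (e p.2)⟫_ℂ‖ ^ 2 =
      density w p.1 * ‖⟪e p.1, b (e p.2)⟫_ℂ‖ ^ 2 := by
  rw [norm_mul, mul_pow, Complex.norm_real, Real.norm_of_nonneg (Real.sqrt_nonneg _),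
    Real.sq_sqrt (density_pos w _).le]

theorem PreGNS.hasSum_embed {w : Weights} (b : PreGNS w) :
    HasSum (fun p : ℤ × ℤ => ‖(√(density w p.1) : ℂ) * ⟪e p.1, b.op (e p.2)⟫_ℂ‖ ^ 2) (‖b‖ ^ 2) := by
  have hrow : ∀ k, HasSum (fun j => ‖(√(density w k) : ℂ) * ⟪e k, b.op (e j)⟫_ℂ‖ ^ 2)
      (density w k * ‖star b.op (e k)‖ ^ 2) := fun k => by
    have := (hasSum_row b.op k).mul_left (density w k)
    exact this.congr_fun fun j => (norm_embed w b.op (k, j))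
  have hs : Summable fun p : ℤ × ℤ => ‖(√(density w p.1) : ℂ) * ⟪e p.1, b.op (e p.2)⟫_ℂ‖ ^ 2 := by
    refine (summable_prod_of_nonneg fun p => by positivity).2 ⟨fun k => (hrow k).summable, ?_⟩
    exact b.summable.congr fun k => ((hrow k).tsum_eq).symm
  have := hs.tsum_prod' fun k => (hrow k).summable
  rw [tsum_congr fun k => (hrow k).tsum_eq, ← b.norm_sq] at this
  rw [← this]
  exact hs.hasSum

theorem memlp_two {ι : Type*} {f : ι → ℂ} (h : Summable fun i => ‖f i‖ ^ 2) :
    Memℓp (E := fun _ => ℂ) f 2 := by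
  refine memℓp_gen ?_
  have h2 : (2 : ℝ≥0∞).toReal = ((2 : ℕ) : ℝ) := by norm_num
  simpa only [h2, Real.rpow_natCast] using h

theorem lp_norm_sq {ι : Type*} (f : lp (fun _ : ι => ℂ) 2) : ‖f‖ ^ 2 = ∑' i, ‖f i‖ ^ 2 := by
  have h := lp.norm_rpow_eq_tsum (p := 2) (by norm_num) f
  have h2 : (2 : ℝ≥0∞).toReal = ((2 : ℕ) : ℝ) := by norm_num
  simpa only [h2, Real.rpow_natCast] using h

/-- The isometric embedding `b ↦ (√(S(k)/w(k)²) ⟨e_k, b e_j⟩)_{k,j}`. -/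
def embed (w : Weights) : PreGNS w →ₗᵢ[ℂ] lp (fun _ : ℤ × ℤ => ℂ) 2 where
  toFun b := ⟨fun p => (√(density w p.1) : ℂ) * ⟪e p.1, b.op (e p.2)⟫_ℂ,
    memlp_two b.hasSum_embed.summable⟩
  map_add' b c := by
    ext p
    change _ = (√(density w p.1) : ℂ) * ⟪e p.1, b.op (e p.2)⟫_ℂ +
      (√(density w p.1) : ℂ) * ⟪e p.1, c.op (e p.2)⟫_ℂ
    rw [← mul_add, ← inner_add_right]
    rfl
  map_smul' r b := by
    ext p
    change _ = r * ((√(density w p.1) : ℂ) * ⟪e p.1, b.op (e p.2)⟫_ℂ)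
    rw [mul_left_comm, ← inner_smul_right]
    rfl
  norm_map' b := by
    rw [← sq_eq_sq₀ (norm_nonneg _) (norm_nonneg _), lp_norm_sq]
    exact b.hasSum_embed.tsum_eq

/-- The continuous extension of `embed` to `ℋ`. -/
def embedGNS (w : Weights) : GNS w →L[ℂ] lp (fun _ : ℤ × ℤ => ℂ) 2 :=
  (embed w).toContinuousLinearMap.extend (UniformSpace.Completion.toComplL (𝕜 := ℂ))

theorem embedGNS_coe (w : Weights) (b : PreGNS w) : embedGNS w (b : GNS w) = embed w b :=
  ContinuousLinearMap.extend_eq (embed w).toContinuousLinearMap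
    (e := UniformSpace.Completion.toComplL (𝕜 := ℂ))
    (UniformSpace.Completion.denseRange_coe) (UniformSpace.Completion.isUniformInducing_coe _) b

theorem norm_embedGNS (w : Weights) (b : GNS w) : ‖embedGNS w b‖ = ‖b‖ := by
  induction b using UniformSpace.Completion.induction_on with
  | hp => exact isClosed_eq (embedGNS w).continuous.norm continuous_norm
  | ih b => rw [embedGNS_coe, LinearIsometry.norm_map, UniformSpace.Completion.norm_coe]

/-- The matrix coefficient `b_{kj} = ⟨e_k, b e_j⟩` of `b ∈ ℋ`: the continuous extension to `ℋ` of
the matrix coefficient of operators (see `entry_coe`). -/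
def entry (w : Weights) (k j : ℤ) : GNS w →L[ℂ] ℂ :=
  ((√(density w k) : ℂ)⁻¹) • (lp.evalCLM ℂ (fun _ : ℤ × ℤ => ℂ) 2 (k, j)) ∘L embedGNS w

theorem entry_apply (w : Weights) (k j : ℤ) (b : GNS w) :
    entry w k j b = (√(density w k) : ℂ)⁻¹ * embedGNS w b (k, j) := rfl

theorem sqrt_density_ne (w : Weights) (k : ℤ) : (√(density w k) : ℂ) ≠ 0 := by
  have := Real.sqrt_pos.2 (density_pos w k)
  exact_mod_cast this.ne'

theorem entry_coe (w : Weights) (k j : ℤ) (b : PreGNS w) :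
    entry w k j (b : GNS w) = ⟪e k, b.op (e j)⟫_ℂ := by
  rw [entry_apply, embedGNS_coe]
  exact inv_mul_cancel_left₀ (sqrt_density_ne w k) _

/-- An element of `ℋ` is determined by its matrix coefficients. -/
theorem entry_ext {w : Weights} {b c : GNS w} (h : ∀ k j, entry w k j b = entry w k j c) :
    b = c := by
  rw [← sub_eq_zero, ← norm_eq_zero, ← norm_embedGNS, norm_eq_zero]
  ext ⟨k, j⟩
  have := h k j
  rw [entry_apply, entry_apply] at this
  have := mul_left_cancel₀ (inv_ne_zero (sqrt_density_ne w k)) this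
  rw [map_sub]
  change embedGNS w b (k, j) - embedGNS w c (k, j) = 0
  rw [this, sub_self]

/-! ### The quantum Dirac operator -/

/-- The matrix of `[b, U_w] = b U_w - U_w b` in terms of the matrix of `b`. -/
def commMatrix (w : Weights) (m : ℤ → ℤ → ℂ) (k j : ℤ) : ℂ :=
  m k (j + 1) * w j - w (k - 1) * m (k - 1) j

/-- The matrix of `U_w^* b` in terms of the matrix of `b`. -/
def starUwMatrix (w : Weights) (m : ℤ → ℤ → ℂ) (k j : ℤ) : ℂ := w k * m (k + 1) j

/-- The matrix of `D b = -S⁻¹ U_w^* [b, U_w]` in terms of the matrix of `b`. -/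
def diracMatrix (w : Weights) (m : ℤ → ℤ → ℂ) (k j : ℤ) : ℂ :=
  -((w.S k : ℂ)⁻¹ * starUwMatrix w (commMatrix w m) k j)

theorem commMatrix_eq (w : Weights) (b : L2Z →L[ℂ] L2Z) (k j : ℤ) :
    ⟪e k, (b * Uw w - Uw w * b) (e j)⟫_ℂ =
      commMatrix w (fun k j => ⟪e k, b (e j)⟫_ℂ) k j := by
  rw [sub_apply, mul_apply_eq_comp, mul_apply_eq_comp, Uw_e, map_smul,
    inner_sub_right, inner_smul_right, inner_e, inner_e, Uw_apply, commMatrix, inner_e, inner_e]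
  ring

theorem starUwMatrix_eq (w : Weights) (b : L2Z →L[ℂ] L2Z) (k j : ℤ) :
    ⟪e k, (star (Uw w) * b) (e j)⟫_ℂ = starUwMatrix w (fun k j => ⟪e k, b (e j)⟫_ℂ) k j := by
  rw [mul_apply_eq_comp, inner_e, star_Uw_apply, starUwMatrix, inner_e]

/-- If `x` is an operator with `S x = -U_w^* [b, U_w]`, then its matrix is `diracMatrix`. -/
theorem diracMatrix_eq (w : Weights) (b x : L2Z →L[ℂ] L2Z)
    (hx : (star (Uw w) * Uw w - Uw w * star (Uw w)) * x =
      -(star (Uw w) * (b * Uw w - Uw w * b))) (k j : ℤ) :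
    ⟪e k, x (e j)⟫_ℂ = diracMatrix w (fun k j => ⟪e k, b (e j)⟫_ℂ) k j := by
  have hS : ⟪e k, ((star (Uw w) * Uw w - Uw w * star (Uw w)) * x) (e j)⟫_ℂ =
      w.S k * ⟪e k, x (e j)⟫_ℂ := by
    have hadj : star (star (Uw w) * Uw w - Uw w * star (Uw w)) =
        star (Uw w) * Uw w - Uw w * star (Uw w) := by simp
    rw [mul_apply_eq_comp, ← hadj, ContinuousLinearMap.star_eq_adjoint
      (star (Uw w) * Uw w - Uw w * star (Uw w)), ContinuousLinearMap.adjoint_inner_right,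
      commutator_e, inner_smul_left, Complex.conj_ofReal]
  have hne : (w.S k : ℂ) ≠ 0 := by exact_mod_cast (w.S_pos k).ne'
  rw [hx, neg_apply, inner_neg_right, starUwMatrix_eq] at hS
  simp_rw [commMatrix_eq] at hS
  rw [diracMatrix, ← mul_neg, hS, inv_mul_cancel_left₀ hne]

theorem diracMatrix_add (w : Weights) (m m' : ℤ → ℤ → ℂ) (k j : ℤ) :
    diracMatrix w (fun k j => m k j + m' k j) k j = diracMatrix w m k j + diracMatrix w m' k j := by
  simp only [diracMatrix, starUwMatrix, commMatrix]; ring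

theorem diracMatrix_smul (w : Weights) (c : ℂ) (m : ℤ → ℤ → ℂ) (k j : ℤ) :
    diracMatrix w (fun k j => c * m k j) k j = c * diracMatrix w m k j := by
  simp only [diracMatrix, starUwMatrix, commMatrix]; ring

/-- `IsDirac w b f`: `b, f ∈ ℋ` satisfy `f = -S⁻¹ U_w^* [b, U_w]`. -/
def IsDirac (w : Weights) (b f : GNS w) : Prop :=
  ∀ k j, entry w k j f = diracMatrix w (fun k j => entry w k j b) k j

/-- The boundary condition `P_{≥0} σ(b) = 0`. The Fourier coefficient of `σ(b)` at `e^{imφ}` is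
`lim_{k → ∞} ⟨e_k, b e_{k-m}⟩` (see `tendsto_fourierCoeff_symbol`). -/
def APS (w : Weights) (b : GNS w) : Prop :=
  ∀ m : ℤ, 0 ≤ m → Tendsto (fun k => entry w k (k - m) b) atTop (𝓝 0)

/-- On elements of `C*(U_w)`, `APS` says that the Fourier coefficients of `σ(b)` at the
nonnegative frequencies vanish. -/
theorem APS_coe (w : Weights) (b : PreGNS w) (hb : b.op ∈ punctDisk w) :
    APS w (b : GNS w) ↔ ∀ m : ℤ, 0 ≤ m → fourierCoeff (symbol w ⟨b.op, hb⟩) m = 0 := by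
  have h := tendsto_fourierCoeff_symbol w ⟨b.op, hb⟩
  simp only [APS, entry_coe]
  exact ⟨fun H m hm => tendsto_nhds_unique (h m) (H m hm), fun H m hm => H m hm ▸ h m⟩

/-- The domain `{b ∈ ℋ : D b ∈ ℋ, P_{≥0} σ(b) = 0}` of the quantum Dirac operator. -/
def diracDomain (w : Weights) : Submodule ℂ (GNS w) where
  carrier := {b | (∃ f, IsDirac w b f) ∧ APS w b}
  zero_mem' := ⟨⟨0, fun k j => by simp [diracMatrix, starUwMatrix, commMatrix]⟩,
    fun m _ => by simp⟩
  add_mem' := by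
    rintro b c ⟨⟨f, hf⟩, hb⟩ ⟨⟨g, hg⟩, hc⟩
    refine ⟨⟨f + g, fun k j => ?_⟩, fun m hm => ?_⟩
    · simp only [map_add, hf k j, hg k j, diracMatrix_add]
    · simpa using (hb m hm).add (hc m hm)
  smul_mem' := by
    rintro r b ⟨⟨f, hf⟩, hb⟩
    refine ⟨⟨r • f, fun k j => ?_⟩, fun m hm => ?_⟩
    · simp only [map_smul, smul_eq_mul, hf k j, diracMatrix_smul]
    · simpa using (hb m hm).const_mul r

/-- The quantum Dirac operator `D b = -S⁻¹ U_w^* [b, U_w]` with the APS domain. -/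
def Dirac (w : Weights) : GNS w →ₗ.[ℂ] GNS w where
  domain := diracDomain w
  toFun :=
    { toFun := fun b => b.2.1.choose
      map_add' := fun b c => entry_ext fun k j => by
        rw [(b + c).2.1.choose_spec k j, map_add, b.2.1.choose_spec k j, c.2.1.choose_spec k j,
          ← diracMatrix_add]
        simp
      map_smul' := fun r b => entry_ext fun k j => by
        rw [(r • b).2.1.choose_spec k j, RingHom.id_apply, map_smul, b.2.1.choose_spec k j,
          smul_eq_mul, ← diracMatrix_smul]
        simp }

theorem Dirac_spec (w : Weights) (b : (Dirac w).domain) : IsDirac w b (Dirac w b) :=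
  b.2.1.choose_spec

/-! ### The Fourier decomposition -/

/-- The sequences `g` with `∑ a(k)⁻¹ |g(k)|² < ∞`. -/
def weightedL2 (w : Weights) : Submodule ℂ (ℤ → ℂ) where
  carrier := {g | Summable fun k => (w.a k)⁻¹ * ‖g k‖ ^ 2}
  zero_mem' := by simp [summable_zero]
  add_mem' := by
    intro f g hf hg
    refine Summable.of_nonneg_of_le (fun k => ?_) (fun k => ?_) ((hf.add hg).mul_left 2)
    · have := w.a_pos k
      positivity
    · have h1 := inv_pos.2 (w.a_pos k)
      have h2 : ‖(f + g) k‖ ≤ ‖f k‖ + ‖g k‖ := norm_add_le _ _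
      have h3 : ‖(f + g) k‖ ^ 2 ≤ 2 * (‖f k‖ ^ 2 + ‖g k‖ ^ 2) := by
        nlinarith [sq_nonneg (‖f k‖ - ‖g k‖), norm_nonneg ((f + g) k)]
      nlinarith
  smul_mem' := by
    intro r f hf
    refine (Summable.mul_left (‖r‖ ^ 2) hf).congr fun k => ?_
    rw [Pi.smul_apply, norm_smul]
    ring

/-- The weighted Hilbert space `ℓ²_a(ℤ)` with `‖g‖² = ∑ a(k)⁻¹ |g(k)|²`. -/
def WL2 (w : Weights) : Type := weightedL2 w

instance (w : Weights) : AddCommGroup (WL2 w) := inferInstanceAs (AddCommGroup (weightedL2 w))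
instance (w : Weights) : Module ℂ (WL2 w) := inferInstanceAs (Module ℂ (weightedL2 w))

/-- The underlying sequence. -/
def WL2.seq {w : Weights} : WL2 w →ₗ[ℂ] (ℤ → ℂ) := (weightedL2 w).subtype

theorem WL2.ext {w : Weights} {f g : WL2 w} (h : ∀ k, f.seq k = g.seq k) : f = g :=
  Subtype.ext (funext h)

theorem WL2.summable {w : Weights} (g : WL2 w) : Summable fun k => (w.a k)⁻¹ * ‖g.seq k‖ ^ 2 :=
  Subtype.property (p := (· ∈ weightedL2 w)) g

theorem WL2.summable_inner {w : Weights} (f g : WL2 w) :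
    Summable fun k => ((w.a k : ℂ))⁻¹ * (starRingEnd ℂ (f.seq k) * g.seq k) := by
  refine Summable.of_norm_bounded (f.summable.add g.summable) fun k => ?_
  have h1 := inv_pos.2 (w.a_pos k)
  rw [norm_mul, norm_mul, RCLike.norm_conj, norm_inv, Complex.norm_real,
    Real.norm_of_nonneg (w.a_pos k).le, ← mul_add]
  refine mul_le_mul_of_nonneg_left ?_ h1.le
  nlinarith [sq_nonneg (‖f.seq k‖ - ‖g.seq k‖), sq_nonneg (‖f.seq k‖), sq_nonneg (‖g.seq k‖)]

theorem WL2.inner_self_eq {w : Weights} (g : WL2 w) :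
    ∑' k : ℤ, ((w.a k : ℂ))⁻¹ * (starRingEnd ℂ (g.seq k) * g.seq k) =
      ((∑' k, (w.a k)⁻¹ * ‖g.seq k‖ ^ 2 : ℝ) : ℂ) := by
  rw [Complex.ofReal_tsum]
  refine tsum_congr fun k => ?_
  rw [Complex.conj_mul']
  push_cast
  rfl

/-- The inner product `⟨f, g⟩ = ∑ a(k)⁻¹ conj(f(k)) g(k)` of `ℓ²_a(ℤ)`. -/
@[reducible]
def wl2Core (w : Weights) : InnerProductSpace.Core ℂ (WL2 w) where
  inner f g := ∑' k : ℤ, ((w.a k : ℂ))⁻¹ * (starRingEnd ℂ (f.seq k) * g.seq k)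
  conj_inner_symm f g := by
    rw [Complex.conj_tsum]
    refine tsum_congr fun k => ?_
    rw [map_mul, map_mul, Complex.conj_conj, map_inv₀, Complex.conj_ofReal]
    ring
  re_inner_nonneg g := by
    rw [WL2.inner_self_eq]
    refine (tsum_nonneg fun k => ?_ : (0 : ℝ) ≤ _)
    have := w.a_pos k
    positivity
  add_left f g h := by
    rw [← (WL2.summable_inner f h).tsum_add (WL2.summable_inner g h)]
    refine tsum_congr fun k => ?_
    rw [map_add, Pi.add_apply, map_add]
    ring
  smul_left f g r := by
    rw [← tsum_mul_left]
    refine tsum_congr fun k => ?_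
    rw [map_smul, Pi.smul_apply, smul_eq_mul, map_mul]
    ring
  definite g hg := by
    rw [WL2.inner_self_eq, Complex.ofReal_eq_zero] at hg
    have hnn : ∀ k, 0 ≤ (w.a k)⁻¹ * ‖g.seq k‖ ^ 2 := fun k => by
      have := w.a_pos k
      positivity
    have h := (hasSum_zero_iff_of_nonneg hnn).1 (hg ▸ g.summable.hasSum)
    refine WL2.ext fun k => ?_
    have hk := congrFun h k
    have := w.a_pos k
    simpa [this.ne'] using hk

instance (w : Weights) : NormedAddCommGroup (WL2 w) := (wl2Core w).toNormedAddCommGroup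

instance (w : Weights) : InnerProductSpace ℂ (WL2 w) :=
  InnerProductSpace.ofCore (wl2Core w).toCore

/-- The Hilbert space direct sum `⨁_{n ∈ ℤ} ℓ²_a(ℤ)`. -/
abbrev FourierSum (w : Weights) : Type := lp (fun _ : ℤ => WL2 w) 2

/-- The direct sum `⨁ T⁽ⁿ⁾` of (possibly unbounded) operators `T⁽ⁿ⁾` on `ℓ²_a(ℤ)`, on its maximal
domain `{g : gₙ ∈ dom T⁽ⁿ⁾ for all n, ∑ ‖T⁽ⁿ⁾ gₙ‖² < ∞}`. -/
def directSum {w : Weights} (T : ℤ → WL2 w →ₗ.[ℂ] WL2 w) : FourierSum w →ₗ.[ℂ] FourierSum w where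
  domain :=
    { carrier := {g | ∃ h : ∀ n, g n ∈ (T n).domain,
        Memℓp (E := fun _ => WL2 w) (fun n => T n ⟨g n, h n⟩) 2}
      zero_mem' := ⟨fun n => zero_mem _, by
        have : (fun n => T n ⟨(0 : FourierSum w) n, zero_mem _⟩) = fun _ => (0 : WL2 w) :=
          funext fun n => (T n).map_zero
        rw [this]
        exact zero_mem_ℓp'⟩
      add_mem' := by
        rintro f g ⟨hf, hf'⟩ ⟨hg, hg'⟩
        refine ⟨fun n => add_mem (hf n) (hg n), ?_⟩
        convert hf'.add hg' using 1
        funext n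
        exact (T n).map_add ⟨f n, hf n⟩ ⟨g n, hg n⟩
      smul_mem' := by
        rintro r f ⟨hf, hf'⟩
        refine ⟨fun n => Submodule.smul_mem _ r (hf n), ?_⟩
        convert hf'.const_smul r using 1
        funext n
        exact (T n).map_smul r ⟨f n, hf n⟩ }
  toFun :=
    { toFun := fun g => ⟨fun n => T n ⟨g.1 n, g.2.choose n⟩, g.2.choose_spec⟩
      map_add' := fun f g => by
        ext1
        funext n
        exact (T n).map_add ⟨f.1 n, f.2.choose n⟩ ⟨g.1 n, g.2.choose n⟩
      map_smul' := fun r f => by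
        ext1
        funext n
        exact (T n).map_smul r ⟨f.1 n, f.2.choose n⟩ }

/-- The operator `Φ⁻¹ T Φ` on `ℋ`, with domain `Φ⁻¹(dom T)`, for an operator `T` on
`⨁_{n ∈ ℤ} ℓ²_a(ℤ)`. -/
def transport {w : Weights} (Φ : GNS w ≃ₗᵢ[ℂ] FourierSum w)
    (T : FourierSum w →ₗ.[ℂ] FourierSum w) : GNS w →ₗ.[ℂ] GNS w where
  domain := T.domain.comap Φ.toLinearEquiv.toLinearMap
  toFun := Φ.symm.toLinearEquiv.toLinearMap ∘ₗ T.toFun ∘ₗ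
    (Φ.toLinearEquiv.toLinearMap.restrict fun _ h => h)

/-! ### The parametrices -/

/-- The coefficients of `Q⁽ⁿ⁾ g(k) = ∑_l qKernel n k l * g(l)`. -/
def qKernel (w : Weights) (n k l : ℤ) : ℝ :=
  if 0 < n then
    if l < k then
      -((∏ i ∈ Finset.range n.toNat, w (l + i)) / (∏ i ∈ Finset.range n.toNat, w (k + i)) *
        (w.S l / w l ^ 2))
    else 0
  else
    if k ≤ l then
      (∏ i ∈ Finset.range (-n).toNat, w (k - 1 - i)) /
        (∏ i ∈ Finset.range (-n).toNat, w (l - 1 - i)) * (w.S l / w l ^ 2)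
    else 0

/-- The operator `Q⁽ⁿ⁾` in `ℓ²_a(ℤ)` on its maximal domain: the `g ∈ ℓ²_a(ℤ)` for which the series
defining `Q⁽ⁿ⁾ g(k)` converge and `Q⁽ⁿ⁾ g ∈ ℓ²_a(ℤ)`. -/
def parametrix (w : Weights) (n : ℤ) : WL2 w →ₗ.[ℂ] WL2 w where
  domain :=
    { carrier := {g | (∀ k, Summable fun l => (qKernel w n k l : ℂ) * g.seq l) ∧
        (fun k => ∑' l, (qKernel w n k l : ℂ) * g.seq l) ∈ weightedL2 w}
      zero_mem' := by
        refine ⟨fun k => by simp [summable_zero], ?_⟩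
        simp only [map_zero, Pi.zero_apply, mul_zero, tsum_zero]
        exact zero_mem _
      add_mem' := by
        rintro f g ⟨hf, hf'⟩ ⟨hg, hg'⟩
        refine ⟨fun k => ?_, ?_⟩
        · simpa only [map_add, Pi.add_apply, mul_add] using (hf k).add (hg k)
        · simp only [map_add, Pi.add_apply, mul_add, fun k => (hf k).tsum_add (hg k)]
          exact add_mem hf' hg'
      smul_mem' := by
        rintro r f ⟨hf, hf'⟩
        refine ⟨fun k => ?_, ?_⟩
        · simpa only [map_smul, Pi.smul_apply, smul_eq_mul, mul_left_comm] using
            (hf k).mul_left r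
        · simp only [map_smul, Pi.smul_apply, smul_eq_mul, mul_left_comm _ r, tsum_mul_left]
          exact Submodule.smul_mem _ r hf' }
  toFun :=
    { toFun := fun g => ⟨fun k => ∑' l, (qKernel w n k l : ℂ) * g.1.seq l, g.2.2⟩
      map_add' := fun f g => WL2.ext fun k => by
        change ∑' l, (qKernel w n k l : ℂ) * (f.1 + g.1).seq l =
          (∑' l, (qKernel w n k l : ℂ) * f.1.seq l) + ∑' l, (qKernel w n k l : ℂ) * g.1.seq l
        rw [← (f.2.1 k).tsum_add (g.2.1 k)]
        simp only [map_add, Pi.add_apply, mul_add]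
      map_smul' := fun r f => WL2.ext fun k => by
        change ∑' l, (qKernel w n k l : ℂ) * (r • f.1).seq l =
          r * ∑' l, (qKernel w n k l : ℂ) * f.1.seq l
        rw [← tsum_mul_left]
        simp only [map_smul, Pi.smul_apply, smul_eq_mul, mul_left_comm _ r] }

end QuantumDisk

end

namespace QuantumDisk

/-! ### Matrix units in `C*(U_w)` -/

/-! Write $d(k)=S(k)/w(k)^2=1/a(k)$. On the diagonals $g_n(k)=b_{k,k+n}$ the equation $Db=f$
decouples into the first-order recursions $g_n(k)-\frac{w(k+n)}{w(k)}g_n(k+1)=d(k)f_n(k)$. An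
integrating factor $P_n$ with $P_n(k+1)w(k)=P_n(k)w(k+n)$ turns each left side, after multiplication
by $P_n(k)$, into a difference of consecutive values of $P_ng_n$. Summing from $+\infty$ when
$n\le0$, and from $-\infty$ when $n>0$, gives the kernels of $Q^{(n)}$.

The homogeneous solutions are $c/P_n$. For $n>0$ they are bounded away from $0$ on $k\le0$ unless
$c=0$, while $\sum_{k\le0}d(k)=\infty$, so membership in $\ell^2_a$ excludes them
(`eq_zero_of_mem_weightedL2`). For $n\le0$ the factor $P_n$ is bounded on $k\ge0$, so the APS limit
$0$ forces $c=0$ (`eq_zero_of_tendsto`). Conversely the series for $n\le0$ tend to $0$ at $+\infty$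
(`tendsto_tsum_qKernel`). Hence $Q$, on its maximal domain, inverts $D$ on both sides.

Boundedness of $\tilde Q$ is Schur's test with respect to the measure $d$, uniformly in $n\ne0$. In
$P_n(l)/P_n(k)$ all but one of the $|n|$ ratios of weights are bounded by $1$. The surviving one,
$w(l)/w(k)$ or $w(k-1)/w(l-1)$, makes row and column sums telescope to at most $2$ and $2\sup_l
w(l)/w(l-1)$. For $n=0$ no ratio survives, which is why $Q^{(0)}$ is kept apart.

The Fourier map is isometric by rearranging a double sum. It is onto because $C^*(U_w)$ contains all
matrix units, so the closed range of the isometry into matrices contains every basis vector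
(`embedGNS_surjective`). -/

theorem clm_ext_e {x y : L2Z →L[ℂ] L2Z} (h : ∀ k, x (e k) = y (e k)) : x = y := by
  rw [← star_star x, ← star_star y]
  congr 1
  exact op_ext fun k => by rw [star_star, star_star, h]

theorem norm_diag_le (f : ℤ → ℂ) (C : ℝ) (hf : ∀ k, ‖f k‖ ≤ C) : ‖diag f C hf‖ ≤ C :=
  LinearMap.mkContinuous_norm_le _ ((norm_nonneg (f 0)).trans (hf 0)) _

theorem diag_e (f : ℤ → ℂ) (C : ℝ) (hf : ∀ k, ‖f k‖ ≤ C) (k : ℤ) :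
    diag f C hf (e k) = f k • e k := by
  ext j
  rw [diag_apply, lp.coeFn_smul, Pi.smul_apply, e_apply, smul_eq_mul]
  by_cases h : j = k
  · rw [h]
  · simp [h]

theorem norm_le_of_diagonal {x : L2Z →L[ℂ] L2Z} {f : ℤ → ℂ} {C : ℝ}
    (hx : ∀ k, x (e k) = f k • e k) (hf : ∀ k, ‖f k‖ ≤ C) : ‖x‖ ≤ C := by
  have h : x = diag f C hf := clm_ext_e fun k => by rw [hx, diag_e]
  exact h ▸ norm_diag_le f C hf

/-- The algebra is non-unital, so only polynomials without constant term in $U_w^*U_w$ are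
available; this accounts for the extra factor $w(k)^2$. -/
theorem exists_polynomial_mem_punctDisk (w : Weights) (q : Polynomial ℝ) :
    ∃ x ∈ punctDisk w, ∀ k, x (e k) = ((w k ^ 2 * q.eval (w k ^ 2) : ℝ) : ℂ) • e k := by
  have hA : star (Uw w) * Uw w ∈ punctDisk w := mul_mem (star_mem (Uw_mem w)) (Uw_mem w)
  induction q using Polynomial.induction_on with
  | C a =>
    refine ⟨(a : ℂ) • (star (Uw w) * Uw w), SMulMemClass.smul_mem _ hA, fun k => ?_⟩
    rw [smul_apply, star_Uw_mul_Uw_e, smul_smul, Polynomial.eval_C]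
    push_cast
    rw [mul_comm]
  | add p q hp hq =>
    obtain ⟨x, hx, hx'⟩ := hp
    obtain ⟨y, hy, hy'⟩ := hq
    refine ⟨x + y, add_mem hx hy, fun k => ?_⟩
    rw [add_apply, hx', hy', ← add_smul, Polynomial.eval_add]
    push_cast
    rw [mul_add]
  | monomial n a h =>
    obtain ⟨x, hx, hx'⟩ := h
    refine ⟨star (Uw w) * Uw w * x, mul_mem hA hx, fun k => ?_⟩
    rw [mul_apply_eq_comp, hx', map_smul, star_Uw_mul_Uw_e, smul_smul]
    congr 1
    simp only [Polynomial.eval_mul, Polynomial.eval_C, Polynomial.eval_pow, Polynomial.eval_X]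
    push_cast
    ring

/-- Strict monotonicity of $w$ isolates the eigenvalue $w(j)^2$, so the projection onto $e_j$ is a
continuous function of $U_w^*U_w$ vanishing at $0$. Weierstrass approximation exhibits it as a norm
limit. -/
theorem exists_projection_mem_punctDisk (w : Weights) (j : ℤ) :
    ∃ x ∈ punctDisk w, ∀ i, x (e i) = if i = j then e j else 0 := by
  have hb : ∀ k, ‖(Pi.single j 1 : ℤ → ℂ) k‖ ≤ 1 := fun k => by
    rw [Pi.single_apply]; split_ifs <;> simp
  refine ⟨diag (Pi.single j 1) 1 hb, ?_, fun i => ?_⟩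
  swap
  · rw [diag_e, Pi.single_apply]
    split_ifs with h
    · rw [h, one_smul]
    · rw [zero_smul]
  have hcl : IsClosed (punctDisk w : Set (L2Z →L[ℂ] L2Z)) :=
    NonUnitalStarAlgebra.elemental.isClosed ℂ (Uw w)
  rw [← SetLike.mem_coe, ← hcl.closure_eq, Metric.mem_closure_iff]
  intro ε hε
  -- By monotonicity, the nearest other eigenvalues are the two neighbours $w(j\pm1)^2$.
  obtain ⟨δ, hδ, hsep⟩ : ∃ δ > 0, ∀ i, i ≠ j → δ ≤ |w i ^ 2 - w j ^ 2| := by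
    refine ⟨min (w j ^ 2 - w (j - 1) ^ 2) (w (j + 1) ^ 2 - w j ^ 2), lt_min (w.S_pos j) ?_, ?_⟩
    · have := w.S_pos (j + 1)
      rwa [Weights.S, add_sub_cancel_right] at this
    · intro i hi
      rcases lt_or_gt_of_ne hi with h | h
      · have h1 := w.strictMono.monotone (show i ≤ j - 1 by lia)
        have h2 := pow_le_pow_left₀ (w.pos i).le h1 2
        exact (min_le_left _ _).trans ((show _ ≤ -(w i ^ 2 - w j ^ 2) by linarith).trans (neg_le_abs _))
      · have h1 := w.strictMono.monotone (show j + 1 ≤ i by lia)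
        have h2 := pow_le_pow_left₀ (w.pos (j + 1)).le h1 2
        exact (min_le_right _ _).trans ((show _ ≤ w i ^ 2 - w j ^ 2 by linarith).trans (le_abs_self _))
  have hj : 0 < w j ^ 2 := pow_pos (w.pos j) 2
  have hp : 0 < w.plus ^ 2 := pow_pos ((w.pos 0).trans_le (w.le_plus 0)) 2
  -- A tent of radius `δ` about $w(j)^2$, divided by $w(j)^2$: multiplied by $x$, it takes the value
  -- $1$ at $w(j)^2$ and $0$ at every other eigenvalue. The tolerance is divided by $w_+^2$ to
  -- absorb that factor $x\le w_+^2$.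
  obtain ⟨q, hq⟩ := exists_polynomial_near_of_continuousOn 0 (w.plus ^ 2)
    (fun x => max 0 (1 - |x - w j ^ 2| / δ) / w j ^ 2) (by fun_prop) (ε / 2 / w.plus ^ 2)
    (by positivity)
  obtain ⟨x, hx, hx'⟩ := exists_polynomial_mem_punctDisk w q
  refine ⟨x, hx, ?_⟩
  rw [dist_comm, dist_eq_norm]
  refine lt_of_le_of_lt (norm_le_of_diagonal
    (f := fun k => ((w k ^ 2 * q.eval (w k ^ 2) : ℝ) : ℂ) - (Pi.single j 1 : ℤ → ℂ) k)
    (C := ε / 2) (fun k => ?_) fun k => ?_) (by linarith)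
  · rw [sub_apply, hx', diag_e, sub_smul]
  · have hk : 0 < w k ^ 2 := pow_pos (w.pos k) 2
    have hkp : w k ^ 2 ≤ w.plus ^ 2 := pow_le_pow_left₀ (w.pos k).le (w.le_plus k) 2
    have hval : (Pi.single j 1 : ℤ → ℂ) k =
        ((w k ^ 2 * (max 0 (1 - |w k ^ 2 - w j ^ 2| / δ) / w j ^ 2) : ℝ) : ℂ) := by
      rw [Pi.single_apply]
      split_ifs with h
      · subst h
        simp [(w.pos k).ne']
      · have := (one_le_div hδ).2 (hsep k h)
        rw [max_eq_left (by linarith)]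
        simp
    rw [hval, ← Complex.ofReal_sub, Complex.norm_real, ← mul_sub, norm_mul,
      Real.norm_of_nonneg hk.le, Real.norm_eq_abs]
    calc w k ^ 2 * |_| ≤ w.plus ^ 2 * (ε / 2 / w.plus ^ 2) :=
          mul_le_mul hkp (hq _ ⟨hk.le, hkp⟩).le (abs_nonneg _) hp.le
      _ = ε / 2 := mul_div_cancel₀ _ hp.ne'

/-- Starting from the diagonal projection, $U_w$ and $U_w^*$ move the row index up and down, up to
nonzero weights. -/
theorem exists_matrixUnit_mem_punctDisk (w : Weights) (k j : ℤ) :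
    ∃ x ∈ punctDisk w, ∀ i, x (e i) = if i = j then e k else 0 := by
  induction k using Int.inductionOn' (b := j) with
  | zero => exact exists_projection_mem_punctDisk w j
  | succ k _ h =>
    obtain ⟨x, hx, hx'⟩ := h
    refine ⟨((w k : ℂ))⁻¹ • (Uw w * x), SMulMemClass.smul_mem _ (mul_mem (Uw_mem w) hx),
      fun i => ?_⟩
    have hne : (w k : ℂ) ≠ 0 := by exact_mod_cast (w.pos k).ne'
    rw [smul_apply, mul_apply_eq_comp, hx']
    split_ifs
    · rw [Uw_e, smul_smul, inv_mul_cancel₀ hne, one_smul]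
    · simp
  | pred k _ h =>
    obtain ⟨x, hx, hx'⟩ := h
    refine ⟨((w (k - 1) : ℂ))⁻¹ • (star (Uw w) * x),
      SMulMemClass.smul_mem _ (mul_mem (star_mem (Uw_mem w)) hx), fun i => ?_⟩
    have hne : (w (k - 1) : ℂ) ≠ 0 := by exact_mod_cast (w.pos _).ne'
    rw [smul_apply, mul_apply_eq_comp, hx']
    split_ifs
    · rw [star_Uw_e, smul_smul, inv_mul_cancel₀ hne, one_smul]
    · simp

theorem exists_preGNS_matrixUnit (w : Weights) (k j : ℤ) :
    ∃ b : PreGNS w, ∀ i, b.op (e i) = if i = j then e k else 0 := by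
  obtain ⟨x, hx, hx'⟩ := exists_matrixUnit_mem_punctDisk w k j
  refine ⟨⟨x, hx, ?_⟩, hx'⟩
  rw [tau_mul_star_lt_top]
  -- A matrix unit has a single nonzero row, so $\tau(bb^*)$ has a single nonzero term.
  refine summable_of_ne_finset_zero (s := {k}) fun i hi => ?_
  rw [Finset.mem_singleton] at hi
  have h := hasSum_row x i
  have h0 : ∀ l, ‖⟪e i, x (e l)⟫_ℂ‖ ^ 2 = 0 := fun l => by
    rw [hx']
    split_ifs
    · rw [inner_e, e_apply, if_neg hi]; simp
    · simp
  simp only [h0] at h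
  rw [h.unique hasSum_zero, mul_zero]

/-! ### The Fourier decomposition of `ℋ` -/

/-- An isometry from a complete space has closed range, and rescaled matrix units put every
`lp.single` in that range. -/
theorem embedGNS_surjective (w : Weights) : Function.Surjective (embedGNS w) := by
  have hiso : Isometry (embedGNS w) :=
    AddMonoidHomClass.isometry_of_norm _ (norm_embedGNS w)
  have hcl : IsClosed (LinearMap.range (embedGNS w).toLinearMap : Set (lp (fun _ : ℤ × ℤ => ℂ) 2)) :=
    hiso.isClosedEmbedding.isClosed_range
  have hsingle : ∀ (p : ℤ × ℤ) (c : ℂ),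
      lp.single 2 p c ∈ LinearMap.range (embedGNS w).toLinearMap := by
    rintro ⟨k, j⟩ c
    obtain ⟨b, hb⟩ := exists_preGNS_matrixUnit w k j
    refine ⟨(((√(density w k) : ℂ)⁻¹ * c) • b : PreGNS w), ?_⟩
    change embedGNS w _ = _
    rw [embedGNS_coe, map_smul]
    ext ⟨k', j'⟩
    change (√(density w k) : ℂ)⁻¹ * c * ((√(density w k') : ℂ) * ⟪e k', b.op (e j')⟫_ℂ) = _
    rw [hb, lp.single_apply, Pi.single_apply, inner_e]
    by_cases h : j' = j
    · by_cases h' : k' = k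
      · subst h h'
        rw [if_pos rfl, if_pos rfl, e_apply, if_pos rfl, mul_one, mul_right_comm,
          inv_mul_cancel₀ (sqrt_density_ne w _), one_mul]
      · rw [if_pos h, e_apply, if_neg h', if_neg (by simp [h'])]; simp
    · rw [if_neg h, if_neg (by simp [h])]; simp
  intro F
  have h := lp.hasSum_single (p := 2) (by norm_num) F
  exact hcl.mem_of_tendsto h (Eventually.of_forall fun s => sum_mem fun p _ => hsingle p _)

theorem inv_a (w : Weights) (k : ℤ) : (w.a k)⁻¹ = density w k := by
  rw [Weights.a, density, inv_div]

theorem WL2.norm_sq {w : Weights} (g : WL2 w) :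
    ‖g‖ ^ 2 = ∑' k, density w k * ‖g.seq k‖ ^ 2 := by
  rw [← inner_self_eq_norm_sq (𝕜 := ℂ) g]
  change (∑' k : ℤ, ((w.a k : ℂ))⁻¹ * (starRingEnd ℂ (g.seq k) * g.seq k)).re = _
  rw [WL2.inner_self_eq, Complex.ofReal_re]
  simp only [inv_a]

theorem WL2.summable_density {w : Weights} (g : WL2 w) :
    Summable fun k => density w k * ‖g.seq k‖ ^ 2 := by
  simpa only [inv_a] using g.summable

theorem mem_weightedL2 {w : Weights} {g : ℤ → ℂ} :
    g ∈ weightedL2 w ↔ Summable fun k => density w k * ‖g k‖ ^ 2 := by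
  simp only [← inv_a]
  rfl

theorem memlp_two' {ι : Type*} {E : ι → Type*} [∀ i, NormedAddCommGroup (E i)] {f : ∀ i, E i} :
    Memℓp f 2 ↔ Summable fun i => ‖f i‖ ^ 2 := by
  have h2 : (2 : ℝ≥0∞).toReal = ((2 : ℕ) : ℝ) := by norm_num
  rw [memℓp_gen_iff (by norm_num)]
  simp only [h2, Real.rpow_natCast]

theorem lp_norm_sq' {ι : Type*} {E : ι → Type*} [∀ i, NormedAddCommGroup (E i)]
    (f : lp E 2) : ‖f‖ ^ 2 = ∑' i, ‖f i‖ ^ 2 := by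
  have h := lp.norm_rpow_eq_tsum (p := 2) (by norm_num) f
  have h2 : (2 : ℝ≥0∞).toReal = ((2 : ℕ) : ℝ) := by norm_num
  simpa only [h2, Real.rpow_natCast] using h

/-- The bijection `(n, k) ↦ (k, k + n)` between diagonal and matrix indices. -/
def diagonalIndex : ℤ × ℤ ≃ ℤ × ℤ where
  toFun p := (p.2, p.2 + p.1)
  invFun p := (p.2 - p.1, p.1)
  left_inv p := by simp
  right_inv p := by simp

theorem density_mul_entry_sq (w : Weights) (k j : ℤ) (b : GNS w) :
    density w k * ‖entry w k j b‖ ^ 2 = ‖embedGNS w b (k, j)‖ ^ 2 := by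
  have h : embedGNS w b (k, j) = (√(density w k) : ℂ) * entry w k j b := by
    rw [entry_apply, mul_inv_cancel_left₀ (sqrt_density_ne w k)]
  rw [h, norm_mul, mul_pow, Complex.norm_real, Real.norm_of_nonneg (Real.sqrt_nonneg _),
    Real.sq_sqrt (density_pos w _).le]

theorem summable_entries (w : Weights) (b : GNS w) :
    Summable fun p : ℤ × ℤ => density w p.2 * ‖entry w p.2 (p.2 + p.1) b‖ ^ 2 := by
  simp only [density_mul_entry_sq]
  exact diagonalIndex.summable_iff.2 (memlp_two'.1 (lp.memℓp (embedGNS w b)))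

theorem tsum_entries (w : Weights) (b : GNS w) :
    ∑' p : ℤ × ℤ, density w p.2 * ‖entry w p.2 (p.2 + p.1) b‖ ^ 2 = ‖b‖ ^ 2 := by
  simp only [density_mul_entry_sq]
  rw [← norm_embedGNS, lp_norm_sq']
  exact diagonalIndex.tsum_eq fun p => ‖embedGNS w b p‖ ^ 2

/-- The `n`-th Fourier coefficient `g_n(k) = b_{k, k+n}`. -/
noncomputable def fourierComponent (w : Weights) (b : GNS w) (n : ℤ) : WL2 w :=
  ⟨fun k => entry w k (k + n) b,
    mem_weightedL2.2 ((summable_entries w b).prod_factor n)⟩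

theorem fourierComponent_seq (w : Weights) (b : GNS w) (n k : ℤ) :
    (fourierComponent w b n).seq k = entry w k (k + n) b := rfl

theorem hasSum_fourierComponent (w : Weights) (b : GNS w) :
    HasSum (fun n => ‖fourierComponent w b n‖ ^ 2) (‖b‖ ^ 2) := by
  simp only [WL2.norm_sq, fourierComponent_seq]
  have h := (summable_entries w b).hasSum.prod_fiberwise
    fun n => ((summable_entries w b).prod_factor n).hasSum
  rwa [tsum_entries] at h

/-- The map `b ↦ (g_n)_n` as a linear isometry. -/
noncomputable def fourierIsometry (w : Weights) : GNS w →ₗᵢ[ℂ] FourierSum w where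
  toFun b := ⟨fourierComponent w b, memlp_two'.2 (hasSum_fourierComponent w b).summable⟩
  map_add' b c := by
    ext1; funext n
    exact WL2.ext fun k => map_add (entry w k (k + n)) b c
  map_smul' r b := by
    ext1; funext n
    exact WL2.ext fun k => map_smul (entry w k (k + n)) r b
  norm_map' b := by
    rw [← sq_eq_sq₀ (norm_nonneg _) (norm_nonneg _), lp_norm_sq']
    exact (hasSum_fourierComponent w b).tsum_eq

theorem fourierIsometry_surjective (w : Weights) : Function.Surjective (fourierIsometry w) := by
  intro F
  have hs : Summable fun p : ℤ × ℤ => density w p.2 * ‖(F p.1).seq p.2‖ ^ 2 := by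
    refine (summable_prod_of_nonneg fun p => ?_).2 ⟨fun n => (F n).summable_density, ?_⟩
    · have := density_pos w p.2
      positivity
    · simp only [← WL2.norm_sq]
      exact memlp_two'.1 (lp.memℓp F)
  -- The matrix with diagonals `F n`, multiplied by the square root of the density as in the
  -- normalisation of `embedGNS`.
  let G : ℤ × ℤ → ℂ := fun p => (√(density w p.1) : ℂ) * (F (p.2 - p.1)).seq p.1
  have hG : Memℓp G 2 := by
    refine memlp_two'.2 ((diagonalIndex.summable_iff).1 (hs.congr fun p => ?_))
    simp only [G, Function.comp_apply, diagonalIndex, Equiv.coe_fn_mk, add_sub_cancel_left]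
    rw [norm_mul, mul_pow, Complex.norm_real, Real.norm_of_nonneg (Real.sqrt_nonneg _),
      Real.sq_sqrt (density_pos w _).le]
  obtain ⟨b, hb⟩ := embedGNS_surjective w ⟨G, hG⟩
  refine ⟨b, ?_⟩
  ext1; funext n
  refine WL2.ext fun k => ?_
  change entry w k (k + n) b = _
  rw [entry_apply, hb]
  change (√(density w k) : ℂ)⁻¹ * ((√(density w k) : ℂ) * (F (k + n - k)).seq k) = _
  rw [inv_mul_cancel_left₀ (sqrt_density_ne w k), add_sub_cancel_left]

/-- The Fourier decomposition `ℋ ≅ ⨁_{n ∈ ℤ} ℓ²_a(ℤ)`. -/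
noncomputable def fourierEquiv (w : Weights) : GNS w ≃ₗᵢ[ℂ] FourierSum w :=
  LinearIsometryEquiv.ofSurjective (fourierIsometry w) (fourierIsometry_surjective w)

theorem fourierEquiv_seq (w : Weights) (b : GNS w) (n k : ℤ) :
    (fourierEquiv w b n).seq k = entry w k (k + n) b := rfl

/-! ### Schur's test -/

/-- Cauchy–Schwarz against the row sums, followed by Tonelli and the column sums. Bounds are on
finite partial sums, so that convergence of the series is part of the conclusion. -/
theorem schur_test {ι κ : Type*} [Nonempty ι] {d : ι → ℝ} {d' : κ → ℝ} (hd : ∀ k, 0 < d k) (hd' : ∀ l, 0 < d' l)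
    {M : ι → κ → ℝ} (hM : ∀ k l, 0 ≤ M k l) {A B : ℝ}
    (hrow : ∀ k (s : Finset κ), ∑ l ∈ s, M k l * d' l ≤ A)
    (hcol : ∀ l (s : Finset ι), ∑ k ∈ s, M k l * d k ≤ B)
    {c : ι → κ → ℂ} (hc : ∀ k l, ‖c k l‖ ≤ M k l * d' l)
    {f : κ → ℂ} (hf : Summable fun l => d' l * ‖f l‖ ^ 2) :
    (∀ k, Summable fun l => c k l * f l) ∧
    (Summable fun k => d k * ‖∑' l, c k l * f l‖ ^ 2) ∧
    ∑' k, d k * ‖∑' l, c k l * f l‖ ^ 2 ≤ A * B * ∑' l, d' l * ‖f l‖ ^ 2 := by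
  have hf0 : ∀ l, 0 ≤ d' l * ‖f l‖ ^ 2 := fun l => mul_nonneg (hd' l).le (sq_nonneg _)
  let T : κ × ι → ℝ := fun p => M p.2 p.1 * d p.2 * (d' p.1 * ‖f p.1‖ ^ 2)
  have hT0 : ∀ p, 0 ≤ T p := fun p => mul_nonneg (mul_nonneg (hM _ _) (hd _).le) (hf0 _)
  have hTsum : ∀ l (s : Finset ι), ∑ k ∈ s, T (l, k) ≤ B * (d' l * ‖f l‖ ^ 2) := fun l s => by
    simp only [T, ← Finset.sum_mul]
    exact mul_le_mul_of_nonneg_right (hcol l s) (hf0 l)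
  have hTl : ∀ l, Summable fun k => T (l, k) := fun l =>
    summable_of_sum_le (fun k => hT0 _) (hTsum l)
  have hTle : ∀ l, ∑' k, T (l, k) ≤ B * (d' l * ‖f l‖ ^ 2) := fun l =>
    (hTl l).tsum_le_of_sum_le (hTsum l)
  have hTs : Summable fun l => ∑' k, T (l, k) :=
    Summable.of_nonneg_of_le (fun l => tsum_nonneg fun k => hT0 _) hTle (hf.mul_left B)
  have hT : Summable T := (summable_prod_of_nonneg hT0).2 ⟨hTl, hTs⟩
  have hTtot : ∑' p, T p ≤ B * ∑' l, d' l * ‖f l‖ ^ 2 := by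
    rw [hT.tsum_prod' hTl, ← tsum_mul_left]
    exact hTs.tsum_le_tsum hTle (hf.mul_left B)
  have hT' : Summable fun p : ι × κ => T p.swap := (Equiv.prodComm ι κ).summable_iff.2 hT
  have hTk : ∀ k, Summable fun l => T (l, k) := fun k => hT'.prod_factor k
  have hTks : Summable fun k => ∑' l, T (l, k) := hT'.prod
  have htot : ∑' k, ∑' l, T (l, k) = ∑' p, T p := by
    rw [← (Equiv.prodComm ι κ).tsum_eq T]
    exact (hT'.tsum_prod' hTk).symm
  have hR : ∀ k, Summable fun l => M k l * (d' l * ‖f l‖ ^ 2) := fun k => by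
    refine ((hTk k).mul_left (d k)⁻¹).congr fun l => ?_
    have := (hd k).ne'
    simp only [T]
    field_simp
  have hRT : ∀ k, d k * ∑' l, M k l * (d' l * ‖f l‖ ^ 2) = ∑' l, T (l, k) := fun k => by
    rw [← tsum_mul_left]
    exact tsum_congr fun l => by simp only [T]; ring
  -- The empty partial sum gives the sign of `A`; this needs at least one row.
  have hA : 0 ≤ A := by simpa using hrow (Classical.arbitrary ι) ∅
  have hfin : ∀ k (s : Finset κ), ∑ l ∈ s, ‖c k l * f l‖ ≤
      √(A * ∑' l, M k l * (d' l * ‖f l‖ ^ 2)) := fun k s => by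
    refine Real.le_sqrt_of_sq_le ?_
    have h1 : ∑ l ∈ s, ‖c k l * f l‖ ≤ ∑ l ∈ s, M k l * d' l * ‖f l‖ :=
      Finset.sum_le_sum fun l _ => by
        rw [norm_mul]; exact mul_le_mul_of_nonneg_right (hc k l) (norm_nonneg _)
    -- Cauchy–Schwarz with $Md'|f|=\sqrt{Md'}\cdot\sqrt{Md'|f|^2}$.
    have h2 : (∑ l ∈ s, M k l * d' l * ‖f l‖) ^ 2 ≤
        (∑ l ∈ s, M k l * d' l) * ∑ l ∈ s, M k l * (d' l * ‖f l‖ ^ 2) :=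
      Finset.sum_sq_le_sum_mul_sum_of_sq_le_mul s
        (fun l _ => mul_nonneg (hM k l) (hd' l).le) (fun l _ => mul_nonneg (hM k l) (hf0 l))
        fun l _ => le_of_eq (by ring)
    have h3 := (hR k).sum_le_tsum s fun l _ => mul_nonneg (hM k l) (hf0 l)
    calc _ ≤ (∑ l ∈ s, M k l * d' l * ‖f l‖) ^ 2 :=
          pow_le_pow_left₀ (Finset.sum_nonneg fun l _ => norm_nonneg _) h1 2
      _ ≤ _ := h2.trans (mul_le_mul (hrow k s) h3
          (Finset.sum_nonneg fun l _ => mul_nonneg (hM k l) (hf0 l)) hA)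
  have hsumm : ∀ k, Summable fun l => ‖c k l * f l‖ := fun k =>
    summable_of_sum_le (fun l => norm_nonneg _) (hfin k)
  have hle : ∀ k, d k * ‖∑' l, c k l * f l‖ ^ 2 ≤ A * ∑' l, T (l, k) := fun k => by
    have h1 : ‖∑' l, c k l * f l‖ ≤ √(A * ∑' l, M k l * (d' l * ‖f l‖ ^ 2)) :=
      (norm_tsum_le_tsum_norm (hsumm k)).trans ((hsumm k).tsum_le_of_sum_le (hfin k))
    have h2 : 0 ≤ A * ∑' l, M k l * (d' l * ‖f l‖ ^ 2) :=
      mul_nonneg hA (tsum_nonneg fun l => mul_nonneg (hM k l) (hf0 l))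
    have h3 := pow_le_pow_left₀ (norm_nonneg _) h1 2
    rw [Real.sq_sqrt h2] at h3
    calc _ ≤ d k * (A * ∑' l, M k l * (d' l * ‖f l‖ ^ 2)) := mul_le_mul_of_nonneg_left h3 (hd k).le
      _ = _ := by rw [← hRT]; ring
  have hS : Summable fun k => d k * ‖∑' l, c k l * f l‖ ^ 2 :=
    Summable.of_nonneg_of_le (fun k => mul_nonneg (hd k).le (sq_nonneg _)) hle (hTks.mul_left A)
  refine ⟨fun k => (hsumm k).of_norm, hS, ?_⟩
  refine (hS.tsum_le_tsum hle (hTks.mul_left A)).trans ?_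
  rw [tsum_mul_left, htot, mul_assoc]
  exact mul_le_mul_of_nonneg_left hTtot hA

/-! ### Sums of the densities -/

/-- The set need not be an interval: removing its maximum `a` leaves points at most `a - 1`, so the
sum telescopes and the skipped increments are nonnegative. -/
theorem sum_sub_pred_le {F : ℤ → ℝ} (hF : Monotone F) {α : ℝ} (hα : ∀ k, α ≤ F k)
    (s : Finset ℤ) : ∀ m, (∀ l ∈ s, l ≤ m) → ∑ l ∈ s, (F l - F (l - 1)) ≤ F m - α := by
  induction s using Finset.induction_on_max with
  | empty => intro m _; simpa using hα m
  | insert a s hs ih =>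
    intro m hm
    rw [Finset.sum_insert fun h => lt_irrefl a (hs a h)]
    have h1 := ih (a - 1) fun l hl => by have := hs l hl; lia
    have h2 := hF (hm a (Finset.mem_insert_self a s))
    linarith

theorem sum_sub_pred_le_of_le {F : ℤ → ℝ} (hF : Monotone F) {α β : ℝ} (hα : ∀ k, α ≤ F k)
    (hβ : ∀ k, F k ≤ β) (s : Finset ℤ) : ∑ l ∈ s, (F l - F (l - 1)) ≤ β - α := by
  obtain ⟨m, hm⟩ := s.bddAbove
  have := sum_sub_pred_le hF hα s m fun l hl => hm hl
  have := hβ m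
  linarith

theorem Weights.w_pred_lt (w : Weights) (k : ℤ) : w (k - 1) < w k := w.strictMono (by lia)

/-- Factor $S(k)=(w(k)-w(k-1))(w(k)+w(k-1))$ and bound the second factor by $2w(k)$. This is the
source of the constant $2$ in the Schur bounds. -/
theorem w_mul_density_le (w : Weights) (k : ℤ) : w k * density w k ≤ 2 * (w k - w (k - 1)) := by
  have h0 := w.pos k
  have h1 := w.w_pred_lt k
  have : w k * density w k = (w k - w (k - 1)) * ((w k + w (k - 1)) / w k) := by
    rw [density, Weights.S]; field_simp; ring
  rw [this, mul_comm 2]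
  refine mul_le_mul_of_nonneg_left ?_ (by linarith)
  rw [div_le_iff₀ h0]; linarith

theorem density_div_w_pred_le (w : Weights) (k : ℤ) :
    density w k / w (k - 1) ≤ 2 * ((w (k - 1))⁻¹ - (w k)⁻¹) := by
  have h0 := w.pos k
  have h1 := w.pos (k - 1)
  have h2 := w_mul_density_le w k
  have : 2 * ((w (k - 1))⁻¹ - (w k)⁻¹) = 2 * (w k - w (k - 1)) / w k / w (k - 1) := by
    field_simp
  rw [this]
  gcongr
  rw [le_div_iff₀ h0]
  linarith

theorem sum_w_mul_density_le (w : Weights) (m : ℤ) (s : Finset ℤ) :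
    ∑ l ∈ s, (if l ≤ m then w l * density w l else 0) ≤ 2 * w m := by
  -- Truncating at `m` makes the increments vanish beyond `m`, so the cut-off sum telescopes.
  have hm : Monotone fun l : ℤ => 2 * w (min l m) := fun i j h => by
    have := w.strictMono.monotone (min_le_min_right m h)
    dsimp only
    linarith
  have h := sum_sub_pred_le_of_le hm (α := 0) (β := 2 * w m)
    (fun k => by have := w.pos (min k m); positivity)
    (fun k => by have := w.strictMono.monotone (min_le_right k m); linarith) s
  rw [sub_zero] at h
  refine (Finset.sum_le_sum fun l _ => ?_).trans h
  split_ifs with hl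
  · rw [min_eq_left hl, min_eq_left (by lia), ← mul_sub]
    exact w_mul_density_le w l
  · rw [min_eq_right (by lia), min_eq_right (by lia), sub_self]

theorem sum_density_div_w_le (w : Weights) (m : ℤ) (s : Finset ℤ) :
    ∑ l ∈ s, (if m < l then density w l / w (l - 1) else 0) ≤ 2 * (w m)⁻¹ := by
  have hinv : ∀ i j : ℤ, i ≤ j → (w j)⁻¹ ≤ (w i)⁻¹ := fun i j h =>
    inv_anti₀ (w.pos i) (w.strictMono.monotone h)
  -- The analogous truncation from below; the minus sign makes the function increasing.
  have hm : Monotone fun l : ℤ => -(2 * (w (max l m))⁻¹) := fun i j h => by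
    have := hinv _ _ (max_le_max_right m h)
    dsimp only
    linarith
  have h := sum_sub_pred_le_of_le hm (α := -(2 * (w m)⁻¹)) (β := 0)
    (fun k => by have := hinv _ _ (le_max_right k m); linarith)
    (fun k => by have := inv_pos.2 (w.pos (max k m)); linarith) s
  rw [zero_sub, neg_neg] at h
  refine (Finset.sum_le_sum fun l _ => ?_).trans h
  split_ifs with hl
  · rw [max_eq_left (by lia), max_eq_left (by lia)]
    have := density_div_w_pred_le w l
    linarith
  · rw [max_eq_right (by lia), max_eq_right (by lia), sub_self]

/-! ### The kernels -/

/-- The integrating factor of the recursion `w(k) g(k) = w(k+n) g(k+1)`. -/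
noncomputable def intFactor (w : Weights) (n k : ℤ) : ℝ :=
  if 0 < n then ∏ i ∈ Finset.range n.toNat, w (k + i)
  else (∏ i ∈ Finset.range (-n).toNat, w (k - 1 - i))⁻¹

theorem intFactor_pos (w : Weights) (n k : ℤ) : 0 < intFactor w n k := by
  unfold intFactor
  split_ifs
  · exact Finset.prod_pos fun i _ => w.pos _
  · exact inv_pos.2 (Finset.prod_pos fun i _ => w.pos _)

/-- Shifting the window of consecutive weights by one changes only its two end factors. -/
theorem intFactor_succ (w : Weights) (n k : ℤ) :
    intFactor w n (k + 1) * w k = intFactor w n k * w (k + n) := by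
  unfold intFactor
  split_ifs with hn
  · obtain ⟨N, rfl⟩ := Int.eq_ofNat_of_zero_le hn.le
    have h := Finset.prod_range_succ' (fun i : ℕ => w (k + i)) N
    rw [Finset.prod_range_succ] at h
    simp only [Nat.cast_add, Nat.cast_one, Nat.cast_zero, add_zero] at h
    rw [Int.toNat_natCast, h]
    congr 1
    exact Finset.prod_congr rfl fun i _ => by ring_nf
  · obtain ⟨N, rfl⟩ : ∃ N : ℕ, n = -N := ⟨(-n).toNat, by lia⟩
    have h := Finset.prod_range_succ' (fun i : ℕ => w (k - i)) N
    rw [Finset.prod_range_succ] at h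
    simp only [Nat.cast_add, Nat.cast_one, Nat.cast_zero, sub_zero] at h
    rw [neg_neg, Int.toNat_natCast]
    have h1 : ∏ i ∈ Finset.range N, w (k + 1 - 1 - i) = ∏ i ∈ Finset.range N, w (k - i) :=
      Finset.prod_congr rfl fun i _ => by ring_nf
    have h2 : ∏ i ∈ Finset.range N, w (k - 1 - i) = ∏ i ∈ Finset.range N, w (k - (i + 1)) :=
      Finset.prod_congr rfl fun i _ => by ring_nf
    have h3 : 0 < ∏ i ∈ Finset.range N, w (k - i) := Finset.prod_pos fun i _ => w.pos _
    have h4 : 0 < ∏ i ∈ Finset.range N, w (k - (i + 1)) := Finset.prod_pos fun i _ => w.pos _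
    rw [h1, h2, ← sub_eq_add_neg]
    field_simp
    linarith

theorem qKernel_of_pos (w : Weights) {n : ℤ} (hn : 0 < n) (k l : ℤ) :
    qKernel w n k l = if l < k then -(intFactor w n l / intFactor w n k * density w l) else 0 := by
  simp only [qKernel, intFactor, density, if_pos hn]

theorem qKernel_of_nonpos (w : Weights) {n : ℤ} (hn : n ≤ 0) (k l : ℤ) :
    qKernel w n k l = if k ≤ l then intFactor w n l / intFactor w n k * density w l else 0 := by
  simp only [qKernel, intFactor, density, if_neg hn.not_gt]
  rw [inv_div_inv]

/-- The kernel is a Green's function: off the diagonal it is, in `k`, a multiple of the homogeneous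
solution `1 / intFactor w n k`. The jump at `l = k` comes from the row `k + 1` if `0 < n`, and from
the row `k` otherwise. -/
theorem qKernel_recursion (w : Weights) (n k l : ℤ) :
    qKernel w n k l - w (k + n) / w k * qKernel w n (k + 1) l =
      if l = k then density w k else 0 := by
  have h0 := intFactor_pos w n k
  have h1 := intFactor_pos w n (k + 1)
  have hq : w (k + n) / w k = intFactor w n (k + 1) / intFactor w n k := by
    rw [div_eq_div_iff (w.pos k).ne' h0.ne', mul_comm, intFactor_succ]
  have hc : ∀ x, intFactor w n (k + 1) / intFactor w n k * (x / intFactor w n (k + 1)) =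
      x / intFactor w n k := fun x => by field_simp
  rw [hq]
  rcases lt_or_ge 0 n with hn | hn
  · rw [qKernel_of_pos w hn, qKernel_of_pos w hn]
    rcases lt_trichotomy l k with h | rfl | h
    · rw [if_pos h, if_pos (by lia), if_neg h.ne, mul_neg, ← mul_assoc, hc, sub_self]
    · rw [if_neg (lt_irrefl _), if_pos (by lia), if_pos rfl, mul_neg, ← mul_assoc, hc,
        div_self h0.ne', one_mul, zero_sub, neg_neg]
    · rw [if_neg (by lia), if_neg (by lia), if_neg h.ne', mul_zero, sub_zero]
  · rw [qKernel_of_nonpos w hn, qKernel_of_nonpos w hn]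
    rcases lt_trichotomy l k with h | rfl | h
    · rw [if_neg (by lia), if_neg (by lia), if_neg h.ne, mul_zero, sub_zero]
    · rw [if_pos le_rfl, if_neg (by lia), if_pos rfl, div_self h0.ne', one_mul, mul_zero,
        sub_zero]
    · rw [if_pos h.le, if_pos (by lia), if_neg h.ne', ← mul_assoc, hc, sub_self]

/-! ### Comparison of the kernels with Schur weights -/

theorem intFactor_div_le_of_pos (w : Weights) {n : ℤ} (hn : 0 < n) {k l : ℤ} (h : l ≤ k) :
    intFactor w n l / intFactor w n k ≤ w l / w k := by
  obtain ⟨N, rfl⟩ : ∃ N : ℕ, n = (N + 1 : ℕ) := ⟨(n - 1).toNat, by lia⟩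
  simp only [intFactor, if_pos hn, Int.toNat_natCast, Finset.prod_range_succ', Nat.cast_zero,
    add_zero]
  have hle : ∏ i ∈ Finset.range N, w (l + (i + 1 : ℕ)) ≤
      ∏ i ∈ Finset.range N, w (k + (i + 1 : ℕ)) :=
    Finset.prod_le_prod (fun i _ => (w.pos _).le) fun i _ => w.strictMono.monotone (by lia)
  have hp : 0 < ∏ i ∈ Finset.range N, w (k + (i + 1 : ℕ)) := Finset.prod_pos fun i _ => w.pos _
  rw [div_le_div_iff₀ (mul_pos hp (w.pos k)) (w.pos k)]
  have := mul_le_mul_of_nonneg_right hle (mul_pos (w.pos l) (w.pos k)).le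
  linarith

/-- The retained factor is the one nearest `k`, whose index is `k - 1`. This shift by one is what
brings the ratio of consecutive weights into the column sums. -/
theorem intFactor_div_le_of_neg (w : Weights) {n : ℤ} (hn : n < 0) {k l : ℤ} (h : k ≤ l) :
    intFactor w n l / intFactor w n k ≤ w (k - 1) / w (l - 1) := by
  obtain ⟨N, rfl⟩ : ∃ N : ℕ, n = -(N + 1 : ℕ) := ⟨(-n - 1).toNat, by lia⟩
  simp only [intFactor, if_neg hn.not_gt, neg_neg, Int.toNat_natCast, Finset.prod_range_succ',
    Nat.cast_zero, sub_zero]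
  have hle : ∏ i ∈ Finset.range N, w (k - 1 - (i + 1 : ℕ)) ≤
      ∏ i ∈ Finset.range N, w (l - 1 - (i + 1 : ℕ)) :=
    Finset.prod_le_prod (fun i _ => (w.pos _).le) fun i _ => w.strictMono.monotone (by lia)
  have hp : 0 < ∏ i ∈ Finset.range N, w (l - 1 - (i + 1 : ℕ)) :=
    Finset.prod_pos fun i _ => w.pos _
  rw [inv_div_inv, div_le_div_iff₀ (mul_pos hp (w.pos _)) (w.pos _)]
  have := mul_le_mul_of_nonneg_right hle (mul_pos (w.pos (k - 1)) (w.pos (l - 1))).le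
  linarith

/-- The supremum of the ratios of consecutive weights. -/
noncomputable def Weights.ratio (w : Weights) : ℝ := ⨆ l : ℤ, w l / w (l - 1)

theorem Weights.div_le_ratio (w : Weights) (k : ℤ) : w k / w (k - 1) ≤ w.ratio :=
  le_ciSup w.ratio_bdd k

theorem Weights.one_le_ratio (w : Weights) : 1 ≤ w.ratio :=
  ((one_le_div (w.pos _)).2 (w.w_pred_lt 0).le).trans (w.div_le_ratio 0)

theorem norm_qKernel (w : Weights) (n k l : ℤ) :
    ‖(qKernel w n k l : ℂ)‖ =
      (if (if 0 < n then l < k else k ≤ l) then intFactor w n l / intFactor w n k else 0) *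
        density w l := by
  have h : 0 ≤ intFactor w n l / intFactor w n k * density w l :=
    mul_nonneg (div_pos (intFactor_pos w n l) (intFactor_pos w n k)).le (density_pos w l).le
  rw [Complex.norm_real]
  rcases lt_or_ge 0 n with hn | hn
  · rw [qKernel_of_pos w hn]
    simp only [if_pos hn, ite_mul, zero_mul]
    split_ifs
    · rw [norm_neg, Real.norm_of_nonneg h]
    · simp
  · rw [qKernel_of_nonpos w hn]
    simp only [if_neg hn.not_gt, ite_mul, zero_mul]
    split_ifs
    · rw [Real.norm_of_nonneg h]
    · simp

/-- One retained ratio of weights is already enough to bound both sums by telescoping, whatever the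
size of `n`. -/
theorem qKernel_schur (w : Weights) {n : ℤ} (hn : n ≠ 0) {f : ℤ → ℂ} (hf : f ∈ weightedL2 w) :
    (∀ k, Summable fun l => (qKernel w n k l : ℂ) * f l) ∧
    (fun k => ∑' l, (qKernel w n k l : ℂ) * f l) ∈ weightedL2 w ∧
    ∑' k, density w k * ‖∑' l, (qKernel w n k l : ℂ) * f l‖ ^ 2 ≤
      2 * (2 * w.ratio) * ∑' l, density w l * ‖f l‖ ^ 2 := by
  simp only [mem_weightedL2] at hf ⊢
  have hC := w.one_le_ratio
  rcases lt_or_gt_of_ne hn with hn | hn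
  · refine schur_test (density_pos w) (density_pos w)
      (M := fun k l => if k ≤ l then w (k - 1) / w (l - 1) else 0) (fun k l => ?_) (fun k s => ?_)
      (fun l s => ?_) (fun k l => ?_) hf
    · split_ifs
      · exact (div_pos (w.pos _) (w.pos _)).le
      · exact le_rfl
    · have h := mul_le_mul_of_nonneg_left (sum_density_div_w_le w (k - 1) s) (w.pos (k - 1)).le
      rw [Finset.mul_sum] at h
      have h2 : w (k - 1) * (2 * (w (k - 1))⁻¹) = 2 := by
        have := w.pos (k - 1); field_simp
      rw [h2] at h
      refine (Finset.sum_le_sum fun l _ => ?_).trans h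
      by_cases hl : k ≤ l
      · rw [if_pos hl, if_pos (by lia)]; exact le_of_eq (by ring)
      · rw [if_neg hl, if_neg (by lia)]; simp
    · have h := mul_le_mul_of_nonneg_left (sum_w_mul_density_le w l s)
        (inv_pos.2 (w.pos (l - 1))).le
      rw [Finset.mul_sum] at h
      -- Only here is the ratio bound really needed; the column bound for `0 < n` is $2$, enlarged
      -- to match.
      have h2 : (w (l - 1))⁻¹ * (2 * w l) ≤ 2 * w.ratio := by
        have := w.div_le_ratio l
        rw [div_eq_mul_inv] at this
        linarith
      refine ((Finset.sum_le_sum fun k _ => ?_).trans h).trans h2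
      by_cases hl : k ≤ l
      · rw [if_pos hl, if_pos hl, div_eq_inv_mul, mul_assoc]
        have h3 := inv_pos.2 (w.pos (l - 1))
        have h4 := density_pos w k
        have h5 := w.w_pred_lt k
        gcongr
      · rw [if_neg hl, if_neg hl]; simp
    · rw [norm_qKernel]
      simp only [hn.not_gt, if_false]
      refine mul_le_mul_of_nonneg_right ?_ (density_pos w l).le
      split_ifs with h
      · exact intFactor_div_le_of_neg w hn h
      · exact le_rfl
  · refine schur_test (density_pos w) (density_pos w)
      (M := fun k l => if l < k then w l / w k else 0) (fun k l => ?_) (fun k s => ?_)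
      (fun l s => ?_) (fun k l => ?_) hf
    · split_ifs
      · exact (div_pos (w.pos _) (w.pos _)).le
      · exact le_rfl
    · have h := mul_le_mul_of_nonneg_left (sum_w_mul_density_le w (k - 1) s)
        (inv_pos.2 (w.pos k)).le
      rw [Finset.mul_sum] at h
      have h2 : (w k)⁻¹ * (2 * w (k - 1)) ≤ 2 := by
        rw [inv_mul_le_iff₀ (w.pos k)]
        have := w.w_pred_lt k
        linarith
      refine ((Finset.sum_le_sum fun l _ => ?_).trans h).trans h2
      by_cases hl : l < k
      · rw [if_pos hl, if_pos (by lia)]; exact le_of_eq (by ring)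
      · rw [if_neg hl, if_neg (by lia)]; simp
    · have h := mul_le_mul_of_nonneg_left (sum_density_div_w_le w l s) (w.pos l).le
      rw [Finset.mul_sum] at h
      have h2 : w l * (2 * (w l)⁻¹) ≤ 2 * w.ratio := by
        rw [mul_left_comm, mul_inv_cancel₀ (w.pos l).ne']
        linarith
      refine ((Finset.sum_le_sum fun k _ => ?_).trans h).trans h2
      by_cases hl : l < k
      · rw [if_pos hl, if_pos hl, div_mul_eq_mul_div, mul_div_assoc]
        have h3 := w.pos l
        have h4 := density_pos w k
        have h5 := w.w_pred_lt k
        have h6 := w.pos (k - 1)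
        gcongr
      · rw [if_neg hl, if_neg hl]; simp
    · rw [norm_qKernel]
      simp only [hn, if_true]
      refine mul_le_mul_of_nonneg_right ?_ (density_pos w l).le
      split_ifs with h
      · exact intFactor_div_le_of_pos w hn h.le
      · exact le_rfl

theorem mem_parametrix_domain {w : Weights} {n : ℤ} (hn : n ≠ 0) (g : WL2 w) :
    g ∈ (parametrix w n).domain := by
  obtain ⟨h1, h2, -⟩ := qKernel_schur w hn (f := g.seq) (Subtype.property g)
  exact ⟨h1, h2⟩

theorem norm_parametrix_le {w : Weights} {n : ℤ} (hn : n ≠ 0) (g : (parametrix w n).domain) :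
    ‖parametrix w n g‖ ≤ 2 * w.ratio * ‖(g : WL2 w)‖ := by
  have h := (qKernel_schur w hn (f := g.1.seq) (Subtype.property g.1)).2.2
  have hC := w.one_le_ratio
  refine le_of_sq_le_sq ?_ (by positivity)
  rw [mul_pow, WL2.norm_sq, WL2.norm_sq]
  -- Schur gives $4C$ for the square of the norm, where $C$ is `w.ratio`; $C\ge1$ weakens it to
  -- $4C^2$.
  refine h.trans (mul_le_mul_of_nonneg_right (by nlinarith) (tsum_nonneg fun l => ?_))
  have := density_pos w l
  positivity

/-! ### The recursion solved by the parametrices -/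

theorem intFactor_anti (w : Weights) {n : ℤ} (hn : n ≤ 0) : Antitone (intFactor w n) := by
  intro k l h
  simp only [intFactor, if_neg hn.not_gt]
  refine inv_anti₀ (Finset.prod_pos fun i _ => w.pos _) ?_
  exact Finset.prod_le_prod (fun i _ => (w.pos _).le) fun i _ => w.strictMono.monotone (by lia)

theorem inv_intFactor_le (w : Weights) {n : ℤ} (hn : n ≤ 0) (k : ℤ) :
    (intFactor w n k)⁻¹ ≤ w.plus ^ (-n).toNat := by
  simp only [intFactor, if_neg hn.not_gt, inv_inv]
  refine (Finset.prod_le_prod (fun i _ => (w.pos _).le) fun i _ => w.le_plus _).trans ?_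
  simp

theorem summable_density_Ici (w : Weights) (k : ℤ) :
    Summable fun l => if k ≤ l then density w l else 0 := by
  have h : Summable fun l => if k - 1 < l then density w l / w (l - 1) else 0 := by
    refine summable_of_sum_le (fun l => ?_) (sum_density_div_w_le w (k - 1))
    dsimp only
    split_ifs
    · exact (div_pos (density_pos w l) (w.pos _)).le
    · exact le_rfl
  refine Summable.of_nonneg_of_le (fun l => ?_) (fun l => ?_) (h.mul_left w.plus)
  · split_ifs
    · exact (density_pos w l).le
    · exact le_rfl
  · by_cases hl : k ≤ l
    · rw [if_pos hl, if_pos (by lia), mul_div_assoc', le_div_iff₀ (w.pos _), mul_comm]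
      exact mul_le_mul_of_nonneg_right (w.le_plus _) (density_pos w l).le
    · rw [if_neg hl, if_neg (by lia), mul_zero]

/-- This includes `n = 0`, where Schur's test is unavailable: the kernel is at most the density,
which is summable towards $+\infty$, and $|f|\le1+|f|^2$. -/
theorem summable_qKernel_of_nonpos (w : Weights) {n : ℤ} (hn : n ≤ 0) {f : ℤ → ℂ}
    (hf : f ∈ weightedL2 w) (k : ℤ) : Summable fun l => (qKernel w n k l : ℂ) * f l := by
  refine Summable.of_norm_bounded ((summable_density_Ici w k).add (mem_weightedL2.1 hf))
    fun l => ?_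
  rw [norm_mul, norm_qKernel]
  simp only [hn.not_gt, if_false]
  have hd := density_pos w l
  split_ifs with h
  · have h1 : intFactor w n l / intFactor w n k ≤ 1 :=
      (div_le_one (intFactor_pos w n k)).2 (intFactor_anti w hn h)
    have h2 : intFactor w n l / intFactor w n k * (density w l * ‖f l‖) ≤
        1 * (density w l * ‖f l‖) := mul_le_mul_of_nonneg_right h1 (by positivity)
    have h3 : ‖f l‖ ≤ 1 + ‖f l‖ ^ 2 := by nlinarith [sq_nonneg (‖f l‖ - 1), norm_nonneg (f l)]
    nlinarith
  · simp only [zero_mul, zero_add]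
    positivity

/-- Dominated convergence: each term vanishes once `k` passes `l`, and the rows `k ≥ 0` are bounded
by a fixed multiple of the row `0`, since `(intFactor w n k)⁻¹` is bounded. -/
theorem tendsto_tsum_qKernel (w : Weights) {n : ℤ} (hn : n ≤ 0) {f : ℤ → ℂ}
    (hf : Summable fun l => (qKernel w n 0 l : ℂ) * f l) :
    Tendsto (fun k => ∑' l, (qKernel w n k l : ℂ) * f l) atTop (𝓝 0) := by
  rw [← tsum_zero (α := ℂ) (β := ℤ) (L := .unconditional ℤ)]
  refine tendsto_tsum_of_dominated_convergence
    (bound := fun l => intFactor w n 0 * w.plus ^ (-n).toNat * ‖(qKernel w n 0 l : ℂ) * f l‖)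
    (hf.norm.mul_left _) (fun l => ?_) ?_
  · refine tendsto_const_nhds.congr' ?_
    filter_upwards [eventually_gt_atTop l] with k hk
    rw [qKernel_of_nonpos w hn, if_neg hk.not_ge, Complex.ofReal_zero, zero_mul]
  · filter_upwards [eventually_ge_atTop 0] with k hk l
    rw [norm_mul, norm_mul, ← mul_assoc]
    refine mul_le_mul_of_nonneg_right ?_ (norm_nonneg _)
    rw [norm_qKernel, norm_qKernel, ← mul_assoc]
    refine mul_le_mul_of_nonneg_right ?_ (density_pos w l).le
    simp only [hn.not_gt, if_false]
    have h0 := intFactor_pos w n 0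
    have hl := intFactor_pos w n l
    have h1 := inv_intFactor_le w hn k
    have hp := (w.pos 0).trans_le (w.le_plus 0)
    by_cases h : k ≤ l
    · rw [if_pos h, if_pos (hk.trans h)]
      have h2 : intFactor w n 0 * w.plus ^ (-n).toNat * (intFactor w n l / intFactor w n 0) =
          intFactor w n l * w.plus ^ (-n).toNat := by field_simp
      rw [h2, div_eq_mul_inv]
      exact mul_le_mul_of_nonneg_left h1 hl.le
    · rw [if_neg h]
      split_ifs <;> positivity

theorem tsum_qKernel_recursion (w : Weights) (n : ℤ) {f : ℤ → ℂ}
    (hf : ∀ k, Summable fun l => (qKernel w n k l : ℂ) * f l) (k : ℤ) :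
    ∑' l, (qKernel w n k l : ℂ) * f l -
      (w (k + n) / w k : ℂ) * ∑' l, (qKernel w n (k + 1) l : ℂ) * f l = density w k * f k := by
  rw [← tsum_mul_left, ← (hf k).tsum_sub ((hf (k + 1)).mul_left _), tsum_eq_single k]
  · have h := qKernel_recursion w n k k
    rw [if_pos rfl] at h
    rw [← h]
    push_cast
    ring
  · intro l hl
    have h := qKernel_recursion w n k l
    rw [if_neg hl] at h
    have h' : ((qKernel w n k l : ℂ) - (w (k + n) / w k : ℂ) * (qKernel w n (k + 1) l : ℂ)) = 0 := by
      exact_mod_cast h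
    rw [← mul_assoc, ← sub_mul, h', zero_mul]

/-! ### Homogeneous solutions and their exclusion -/

theorem intFactor_mul_eq (w : Weights) {n : ℤ} {h : ℤ → ℂ}
    (hh : ∀ k, h k = (w (k + n) / w k : ℂ) * h (k + 1)) (k : ℤ) :
    (intFactor w n k : ℂ) * h k = intFactor w n 0 * h 0 := by
  have step : ∀ k, (intFactor w n (k + 1) : ℂ) * h (k + 1) = intFactor w n k * h k := fun k => by
    have hk : (w k : ℂ) ≠ 0 := by exact_mod_cast (w.pos k).ne'
    have h1 : (intFactor w n (k + 1) * w k : ℂ) = intFactor w n k * w (k + n) := by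
      exact_mod_cast intFactor_succ w n k
    rw [hh k, ← mul_assoc, mul_div_assoc', ← h1, mul_div_cancel_right₀ _ hk]
  induction k using Int.induction_on with
  | zero => rfl
  | succ k ih => rw [step, ih]
  | pred k ih => rw [← ih, ← step, sub_add_cancel]

theorem eq_zero_of_intFactor_mul (w : Weights) {n : ℤ} {h : ℤ → ℂ}
    (hh : ∀ k, (intFactor w n k : ℂ) * h k = intFactor w n 0 * h 0) (h0 : h 0 = 0) (k : ℤ) :
    h k = 0 := by
  have h1 := hh k
  have h2 : (intFactor w n k : ℂ) ≠ 0 := by exact_mod_cast (intFactor_pos w n k).ne'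
  rw [h0, mul_zero] at h1
  exact (mul_eq_zero.1 h1).resolve_left h2

theorem eq_zero_of_tendsto (w : Weights) {n : ℤ} (hn : n ≤ 0) {h : ℤ → ℂ}
    (hh : ∀ k, h k = (w (k + n) / w k : ℂ) * h (k + 1)) (hlim : Tendsto h atTop (𝓝 0)) (k : ℤ) :
    h k = 0 := by
  have hc := intFactor_mul_eq w hh
  refine eq_zero_of_intFactor_mul w hc ?_ k
  have h1 : Tendsto (fun k => (intFactor w n k : ℂ) * h k) atTop (𝓝 0) := by
    refine squeeze_zero_norm' (a := fun k => intFactor w n 0 * ‖h k‖) ?_ ?_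
    · filter_upwards [eventually_ge_atTop 0] with k hk
      rw [norm_mul, Complex.norm_real, Real.norm_of_nonneg (intFactor_pos w n k).le]
      exact mul_le_mul_of_nonneg_right (intFactor_anti w hn hk) (norm_nonneg _)
    · simpa using hlim.norm.const_mul (intFactor w n 0)
  simp only [hc] at h1
  have h2 := tendsto_nhds_unique tendsto_const_nhds h1
  have h3 : (intFactor w n 0 : ℂ) ≠ 0 := by exact_mod_cast (intFactor_pos w n 0).ne'
  exact (mul_eq_zero.1 h2).resolve_left h3

theorem sum_S_Ioc (w : Weights) (m : ℤ) (N : ℕ) :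
    ∑ l ∈ Finset.Ioc m (m + N), w.S l = w (m + N) ^ 2 - w m ^ 2 := by
  induction N with
  | zero => simp
  | succ N ih =>
    have h : Finset.Ioc m (m + (N + 1 : ℕ)) = insert (m + N + 1) (Finset.Ioc m (m + N)) := by
      ext l
      simp only [Finset.mem_Ioc, Finset.mem_insert]
      lia
    rw [h, Finset.sum_insert (by simp), ih, Weights.S, add_sub_cancel_right, Nat.cast_add,
      Nat.cast_one, ← add_assoc]
    ring

/-- On a block $(M,N]$ the densities sum to at least $(w(N)^2-w(M)^2)/w(N)^2$, which exceeds $1/2$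
once $M$ is far enough to the left because $w\to0$. This contradicts Cauchy's criterion. -/
theorem not_summable_density_Iic (w : Weights) :
    ¬ Summable fun l : ℤ => if l ≤ 0 then density w l else 0 := by
  intro hs
  obtain ⟨s, hs⟩ := summable_iff_vanishing_norm.1 hs (1 / 2) (by norm_num)
  obtain ⟨m, hm⟩ := s.bddBelow
  -- Strictly below `s`, for disjointness, and negative, so that the cut-off `l ≤ 0` holds on the
  -- block.
  set N := min m 0 - 1 with hN
  have hN0 : 0 < w N ^ 2 := pow_pos (w.pos N) 2
  have h1 : Tendsto (fun k => w k ^ 2) atBot (𝓝 0) := by simpa using w.tendsto_zero.pow 2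
  obtain ⟨M, hM, hMN⟩ := ((h1.eventually_lt_const (half_pos hN0)).and
    (eventually_le_atBot N)).exists
  obtain ⟨j, hj⟩ := Int.eq_ofNat_of_zero_le (sub_nonneg.2 hMN)
  have hdis : Disjoint (Finset.Ioc M N) s := Finset.disjoint_left.2 fun l hl hl' => by
    have := hm hl'
    rw [Finset.mem_Ioc] at hl
    lia
  have h2 := (le_abs_self _).trans_lt (hs _ hdis)
  have h3 : ∑ l ∈ Finset.Ioc M N, w.S l / w N ^ 2 ≤
      ∑ l ∈ Finset.Ioc M N, (if l ≤ 0 then density w l else 0) := by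
    refine Finset.sum_le_sum fun l hl => ?_
    rw [Finset.mem_Ioc] at hl
    rw [if_pos (by lia), density]
    exact div_le_div_of_nonneg_left (w.S_pos l).le (pow_pos (w.pos l) 2)
      (pow_le_pow_left₀ (w.pos l).le (w.strictMono.monotone hl.2) 2)
  have h4 := sum_S_Ioc w M j
  rw [show M + (j : ℤ) = N by lia] at h4
  rw [← Finset.sum_div, h4] at h3
  have h5 : 1 / 2 < (w N ^ 2 - w M ^ 2) / w N ^ 2 := by
    rw [lt_div_iff₀ hN0]; linarith
  linarith

/-- Since `intFactor w n l ≤ intFactor w n 0` for `l ≤ 0`, a homogeneous solution satisfies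
$|h(l)|\ge|h(0)|$ there; if $h(0)\ne0$ the densities would be summable at $-\infty$. -/
theorem eq_zero_of_mem_weightedL2 (w : Weights) {n : ℤ} (hn : 0 < n) {h : ℤ → ℂ}
    (hh : ∀ k, h k = (w (k + n) / w k : ℂ) * h (k + 1)) (hmem : h ∈ weightedL2 w) (k : ℤ) :
    h k = 0 := by
  have hc := intFactor_mul_eq w hh
  refine eq_zero_of_intFactor_mul w hc ?_ k
  by_contra h0
  have hpos : 0 < ‖h 0‖ ^ 2 := by positivity
  refine not_summable_density_Iic w (Summable.of_nonneg_of_le (fun l => ?_) (fun l => ?_)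
    ((mem_weightedL2.1 hmem).mul_left (‖h 0‖ ^ 2)⁻¹))
  · split_ifs
    · exact (density_pos w l).le
    · exact le_rfl
  · have hd := density_pos w l
    split_ifs with hl
    · have h1 := congrArg norm (hc l)
      have hPl := intFactor_pos w n l
      have hP0 := intFactor_pos w n 0
      rw [norm_mul, norm_mul, Complex.norm_real, Complex.norm_real, Real.norm_of_nonneg hPl.le,
        Real.norm_of_nonneg hP0.le] at h1
      have h2 : intFactor w n l ≤ intFactor w n 0 := by
        rw [← div_le_one hP0]
        exact (intFactor_div_le_of_pos w hn hl).trans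
          ((div_le_one (w.pos 0)).2 (w.strictMono.monotone hl))
      have h3 : ‖h 0‖ ≤ ‖h l‖ := by
        refine le_of_mul_le_mul_left ?_ hPl
        rw [h1]
        exact mul_le_mul_of_nonneg_right h2 (norm_nonneg _)
      rw [le_inv_mul_iff₀ hpos, mul_comm]
      exact mul_le_mul_of_nonneg_left (pow_le_pow_left₀ (norm_nonneg _) h3 2) hd.le
    · positivity

/-! ### The Dirac operator in the Fourier decomposition -/

theorem isDirac_iff (w : Weights) (b f : GNS w) :
    IsDirac w b f ↔ ∀ n k, (fourierEquiv w b n).seq k -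
      (w (k + n) / w k : ℂ) * (fourierEquiv w b n).seq (k + 1) =
        density w k * (fourierEquiv w f n).seq k := by
  have key : ∀ n k, (entry w k (k + n) f = diracMatrix w (fun k j => entry w k j b) k (k + n)) ↔
      ((fourierEquiv w b n).seq k - (w (k + n) / w k : ℂ) * (fourierEquiv w b n).seq (k + 1) =
        density w k * (fourierEquiv w f n).seq k) := fun n k => by
    have hS : (w.S k : ℂ) ≠ 0 := by exact_mod_cast (w.S_pos k).ne'
    have hw : (w k : ℂ) ≠ 0 := by exact_mod_cast (w.pos k).ne'
    simp only [fourierEquiv_seq, diracMatrix, starUwMatrix, commMatrix, density,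
      add_sub_cancel_right]
    rw [show k + 1 + n = k + n + 1 by ring]
    push_cast
    constructor
    · intro h
      rw [h]
      field_simp
      ring
    · intro h
      field_simp at h ⊢
      linear_combination -h
  refine ⟨fun h n k => (key n k).1 (h k (k + n)), fun h k j => ?_⟩
  have := (key (j - k) k).2 (h (j - k) k)
  rwa [add_sub_cancel] at this

theorem APS_iff (w : Weights) (b : GNS w) :
    APS w b ↔ ∀ n ≤ 0, Tendsto (fourierEquiv w b n).seq atTop (𝓝 0) := by
  refine ⟨fun h n hn => ?_, fun h m hm => ?_⟩
  · refine (h (-n) (by lia)).congr fun k => ?_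
    rw [fourierEquiv_seq, sub_neg_eq_add]
  · exact h (-m) (by lia)

/-- The series and the diagonal of `b` solve the same recursion, so their difference is homogeneous.
It vanishes by square summability if `0 < n`, and by the boundary condition if `n ≤ 0`. -/
theorem parametrix_apply_of_isDirac {w : Weights} {b f : GNS w} (hD : IsDirac w b f)
    (hA : APS w b) (n : ℤ) : ∃ h : fourierEquiv w f n ∈ (parametrix w n).domain,
      parametrix w n ⟨fourierEquiv w f n, h⟩ = fourierEquiv w b n := by
  set F := fourierEquiv w f n with hF
  set G := fourierEquiv w b n with hG
  have hrec := (isDirac_iff w b f).1 hD n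
  suffices h : (∀ k, Summable fun l => (qKernel w n k l : ℂ) * F.seq l) ∧
      ∀ k, ∑' l, (qKernel w n k l : ℂ) * F.seq l = G.seq k by
    refine ⟨⟨h.1, ?_⟩, WL2.ext h.2⟩
    rw [funext h.2]
    exact Subtype.property G
  have hs : ∀ k, Summable fun l => (qKernel w n k l : ℂ) * F.seq l := fun k => by
    rcases lt_or_ge 0 n with hn | hn
    · exact (qKernel_schur w hn.ne' (f := F.seq) (Subtype.property F)).1 k
    · exact summable_qKernel_of_nonpos w hn (f := F.seq) (Subtype.property F) k
  refine ⟨hs, fun k => ?_⟩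
  rw [← sub_eq_zero]
  have hhom : ∀ k, ∑' l, (qKernel w n k l : ℂ) * F.seq l - G.seq k = (w (k + n) / w k : ℂ) *
      (∑' l, (qKernel w n (k + 1) l : ℂ) * F.seq l - G.seq (k + 1)) := fun k => by
    have h1 := tsum_qKernel_recursion w n hs k
    have h2 := hrec k
    rw [← hF, ← hG, ← h1] at h2
    linear_combination -h2
  rcases lt_or_ge 0 n with hn | hn
  · exact eq_zero_of_mem_weightedL2 w hn hhom (sub_mem
      (qKernel_schur w hn.ne' (f := F.seq) (Subtype.property F)).2.1 (Subtype.property G)) k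
  · refine eq_zero_of_tendsto w hn hhom ?_ k
    simpa using (tendsto_tsum_qKernel w hn (hs 0)).sub ((APS_iff w b).1 hA n hn)

/-- The boundary condition costs nothing here: for `n ≤ 0` the convergence of one row already forces
the limit $0$. -/
theorem isDirac_and_APS_of_parametrix {w : Weights} {b f : GNS w}
    (h : ∀ n, ∃ h : fourierEquiv w f n ∈ (parametrix w n).domain,
      parametrix w n ⟨fourierEquiv w f n, h⟩ = fourierEquiv w b n) :
    IsDirac w b f ∧ APS w b := by
  rw [isDirac_iff, APS_iff]
  refine ⟨fun n k => ?_, fun n hn => ?_⟩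
  · obtain ⟨hF, hG⟩ := h n
    rw [← hG]
    exact tsum_qKernel_recursion w n hF.1 k
  · obtain ⟨hF, hG⟩ := h n
    rw [← hG]
    exact tendsto_tsum_qKernel w hn (hF.1 0)

/-! ### Direct sums of unbounded operators -/

theorem mem_directSum_domain {w : Weights} {T : ℤ → WL2 w →ₗ.[ℂ] WL2 w} {g G : FourierSum w}
    (h : ∀ n, ∃ h : g n ∈ (T n).domain, T n ⟨g n, h⟩ = G n) :
    ∃ h : g ∈ (directSum T).domain, directSum T ⟨g, h⟩ = G := by
  choose h1 h2 using h
  refine ⟨⟨h1, ?_⟩, ?_⟩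
  · rw [funext h2]
    exact lp.memℓp G
  · ext1
    funext n
    exact h2 n

theorem directSum_bounded {w : Weights} {T : ℤ → WL2 w →ₗ.[ℂ] WL2 w} {C : ℝ} (hC : 0 ≤ C)
    (hdom : ∀ n g, g ∈ (T n).domain) (hT : ∀ n (g : (T n).domain), ‖T n g‖ ≤ C * ‖(g : WL2 w)‖) :
    (∀ g, g ∈ (directSum T).domain) ∧
      ∀ g : (directSum T).domain, ‖directSum T g‖ ≤ C * ‖(g : FourierSum w)‖ := by
  have hle : ∀ (g : FourierSum w) n, ‖T n ⟨g n, hdom n _⟩‖ ^ 2 ≤ C ^ 2 * ‖g n‖ ^ 2 := fun g n => by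
    rw [← mul_pow]
    exact pow_le_pow_left₀ (norm_nonneg _) (hT n _) 2
  have hs : ∀ g : FourierSum w, Summable fun n => C ^ 2 * ‖g n‖ ^ 2 := fun g =>
    (memlp_two'.1 (lp.memℓp g)).mul_left _
  have hs' : ∀ g : FourierSum w, Summable fun n => ‖T n ⟨g n, hdom n _⟩‖ ^ 2 := fun g =>
    Summable.of_nonneg_of_le (fun n => sq_nonneg _) (hle g) (hs g)
  refine ⟨fun g => ⟨fun n => hdom n _, memlp_two'.2 (hs' g)⟩, fun g => ?_⟩
  refine le_of_sq_le_sq ?_ (by positivity)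
  rw [mul_pow, lp_norm_sq', lp_norm_sq', ← tsum_mul_left]
  exact (hs' g.1).tsum_le_tsum (hle g.1) (hs g.1)

/-- Maximal domains do not add in general. As the second sum is everywhere defined, square
summability of the total passes to the first sum by subtraction. -/
theorem directSum_add {w : Weights} {T T' : ℤ → WL2 w →ₗ.[ℂ] WL2 w}
    (h : ∀ g, g ∈ (directSum T').domain) :
    directSum (fun n => T n + T' n) = directSum T + directSum T' := by
  refine LinearPMap.ext (le_antisymm ?_ ?_) fun g h h' => rfl
  · rintro g ⟨hg, hg'⟩
    obtain ⟨hT', hmem⟩ := h g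
    refine ⟨⟨fun n => (hg n).1, ?_⟩, h g⟩
    convert hg'.sub hmem using 1
    funext n
    exact (add_sub_cancel_right _ _).symm
  · rintro g ⟨⟨hT, hmem⟩, ⟨hT', hmem'⟩⟩
    exact ⟨fun n => ⟨hT n, hT' n⟩, hmem.add hmem'⟩

theorem transport_apply {w : Weights} (Φ : GNS w ≃ₗᵢ[ℂ] FourierSum w)
    (T : FourierSum w →ₗ.[ℂ] FourierSum w) (b : (transport Φ T).domain) :
    transport Φ T b = Φ.symm (T ⟨Φ b, b.2⟩) := rfl

theorem transport_add {w : Weights} (Φ : GNS w ≃ₗᵢ[ℂ] FourierSum w)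
    (T T' : FourierSum w →ₗ.[ℂ] FourierSum w) :
    transport Φ (T + T') = transport Φ T + transport Φ T' := by
  refine LinearPMap.ext rfl fun b h h' => ?_
  rw [LinearPMap.add_apply, transport_apply, transport_apply, transport_apply, ← map_add]
  rfl

theorem exists_toPMap_eq {E : Type*} [NormedAddCommGroup E] [NormedSpace ℂ E]
    {T : E →ₗ.[ℂ] E} {C : ℝ} (hC : 0 ≤ C) (hdom : ∀ x, x ∈ T.domain)
    (hT : ∀ x : T.domain, ‖T x‖ ≤ C * ‖(x : E)‖) :
    ∃ A : E →L[ℂ] E, A.toLinearMap.toPMap ⊤ = T ∧ ‖A‖ ≤ C := by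
  refine ⟨LinearMap.mkContinuous (T.toFun ∘ₗ LinearMap.id.codRestrict T.domain hdom) C
    fun x => hT ⟨x, hdom x⟩, ?_, LinearMap.mkContinuous_norm_le _ hC _⟩
  exact LinearPMap.ext (Submodule.eq_top_iff'.2 hdom).symm fun x h h' => rfl

/-! ### The parametrix `Q = Q⁽⁰⁾ + Q̃` -/

theorem ite_parametrix_bounded (w : Weights) (n : ℤ) :
    (∀ g, g ∈ (if n = 0 then (0 : WL2 w →ₗ.[ℂ] WL2 w) else parametrix w n).domain) ∧
    ∀ g : (if n = 0 then (0 : WL2 w →ₗ.[ℂ] WL2 w) else parametrix w n).domain,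
      ‖(if n = 0 then (0 : WL2 w →ₗ.[ℂ] WL2 w) else parametrix w n) g‖ ≤
        2 * w.ratio * ‖(g : WL2 w)‖ := by
  have hC := w.one_le_ratio
  by_cases hn : n = 0
  · rw [if_pos hn]
    refine ⟨fun g => Submodule.mem_top, fun g => ?_⟩
    rw [LinearPMap.zero_apply, norm_zero]
    positivity
  · rw [if_neg hn]
    exact ⟨mem_parametrix_domain hn, norm_parametrix_le hn⟩

theorem ite_parametrix_add (w : Weights) (n : ℤ) :
    (if n = 0 then parametrix w n else 0) + (if n = 0 then 0 else parametrix w n) =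
      parametrix w n := by
  split_ifs
  · exact add_zero _
  · exact zero_add _

end QuantumDisk

theorem mainTheorem1 (w : QuantumDisk.Weights) :
    ∃ Φ : QuantumDisk.GNS w ≃ₗᵢ[ℂ] QuantumDisk.FourierSum w,
      (∀ (b : QuantumDisk.GNS w) (n k : ℤ), (Φ b n).seq k = QuantumDisk.entry w k (k + n) b) ∧
      ∃ (Q : QuantumDisk.GNS w →ₗ.[ℂ] QuantumDisk.GNS w)
        (Qt : QuantumDisk.GNS w →L[ℂ] QuantumDisk.GNS w),
        (∀ b : (QuantumDisk.Dirac w).domain,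
          ∃ h : QuantumDisk.Dirac w b ∈ Q.domain, Q ⟨QuantumDisk.Dirac w b, h⟩ = b) ∧
        (∀ c : Q.domain,
          ∃ h : Q c ∈ (QuantumDisk.Dirac w).domain, QuantumDisk.Dirac w ⟨Q c, h⟩ = c) ∧
        Q = QuantumDisk.transport Φ (QuantumDisk.directSum (QuantumDisk.parametrix w)) ∧
        Qt.toLinearMap.toPMap ⊤ = QuantumDisk.transport Φ
          (QuantumDisk.directSum fun n => if n = 0 then 0 else QuantumDisk.parametrix w n) ∧
        Q = QuantumDisk.transport Φ
            (QuantumDisk.directSum fun n => if n = 0 then QuantumDisk.parametrix w n else 0) +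
          Qt.toLinearMap.toPMap ⊤ ∧
        ‖Qt‖ ^ 2 ≤ 4 * (⨆ l : ℤ, w l / w (l - 1)) ^ 2 := by
  open QuantumDisk in
  have hC : 0 ≤ 2 * w.ratio := by linarith [w.one_le_ratio]
  obtain ⟨hdom, hbdd⟩ := directSum_bounded hC (fun n => (ite_parametrix_bounded w n).1)
    fun n => (ite_parametrix_bounded w n).2
  obtain ⟨Qt, hQt, hnorm⟩ := exists_toPMap_eq
    (T := transport (fourierEquiv w) (directSum fun n => if n = 0 then 0 else parametrix w n))
    hC (fun b => hdom (fourierEquiv w b)) fun b => by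
      rw [transport_apply, LinearIsometryEquiv.norm_map]
      refine (hbdd _).trans_eq ?_
      rw [LinearIsometryEquiv.norm_map]
  refine ⟨fourierEquiv w, fourierEquiv_seq w,
    transport (fourierEquiv w) (directSum (parametrix w)), Qt, fun b => ?_, fun c => ?_, rfl, hQt,
    ?_, ?_⟩
  · obtain ⟨h, h'⟩ := mem_directSum_domain (parametrix_apply_of_isDirac (Dirac_spec w b) b.2.2)
    refine ⟨h, ?_⟩
    rw [transport_apply, LinearIsometryEquiv.symm_apply_eq]
    exact h'
  · have hc : IsDirac w (transport (fourierEquiv w) (directSum (parametrix w)) c) c ∧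
        APS w (transport (fourierEquiv w) (directSum (parametrix w)) c) :=
      isDirac_and_APS_of_parametrix fun n => ⟨c.2.choose n, by
        rw [transport_apply, LinearIsometryEquiv.apply_symm_apply]
        rfl⟩
    -- The value of `Dirac` is a chosen witness, identified with `c` because matrix coefficients
    -- determine an element.
    refine ⟨⟨⟨c, hc.1⟩, hc.2⟩, entry_ext fun k j => ?_⟩
    rw [Dirac_spec w _ k j, hc.1 k j]
  · rw [hQt, ← transport_add, ← directSum_add hdom]
    simp only [ite_parametrix_add]
  · calc ‖Qt‖ ^ 2 ≤ (2 * w.ratio) ^ 2 := pow_le_pow_left₀ (norm_nonneg _) hnorm 2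
      _ = 4 * w.ratio ^ 2 := by ring
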